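/- Let $\eta(q)=q^{1/24}\prod_{n\ge 1}(1-q^n)$, regarded as a $q$-series, and let $\zeta_d=e^{2\pi i/d}$. For a complex K3 surface $S$, the group $H^2(S,\mathbb Z)$ with its intersection form is the K3 lattice $U^{\oplus 3}\oplus E_8(-1)^{\oplus 2}$. For $w\in H^2(S,\mathbb Z)$ (representing a class in $H^2(S,\mu_p)=H^2(S,\mathbb Z)/pH^2(S,\mathbb Z)$) write $w^2=w\cdot w\in\mathbb Z$, and put $\delta_{w,0}=1$ if $w\in pH^2(S,\mathbb Z)$ and $\delta_{w,0}=0$ otherwise. For an integer $r\ge 1$, a prime $p$ and the Picard number $\rho$ of the surface, the Vafa--Witten invariants $\alpha_{1,r}(n)$, $\alpha_{2,p}(w;n)$, $\alpha_{3,p}(n)$ are defined by $$\sum_{n\in\mathbb Z}\alpha_{1,r}(n)q^n=\sum_{d\mid r}\frac{d}{r^2}\,q^r\sum_{j=0}^{d-1}\eta\big(\zeta_d^jq^{r/d^2}\big)^{-24},$$ $$\sum_{n\in\mathbb Z}\alpha_{2,p}(w;n)q^{n/p}=\frac{\delta_{w,0}}{p^2}\eta(q^p)^{-24}+\frac1p\sum_{j=0}^{p-1}e^{-\pi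 i jw^2/p}\,\eta\big(\zeta_p^jq^{1/p}\big)^{-24},$$ $$\sum_{n\in\mathbb Z}\alpha_{3,p}(n)q^{n/p}=\frac{q^p}{p^2}\eta(q^p)^{-24}+q^p\Big(p^{21}\eta\big(q^{1/p}\big)^{-24}+p^{\rho-1}\sum_{j=1}^{p-1}\eta\big(\zeta_p^jq^{1/p}\big)^{-24}\Big).$$ For a sequence $\alpha$ and $d,n\ge 0$ let $J_\alpha^{d,n}(X)=\sum_{j=0}^{d}\binom dj\alpha(n+j)X^j$ be its Jensen polynomials. Say that $\alpha$ eventually satisfies all higher-order Turán inequalities (equality being allowed) if for every $d$ there is an $N$ such that for all $n\ge N$ the polynomial $J_\alpha^{d,n}$ has real coefficients and is hyperbolic, i.e. all its roots are real; here the zero polynomial, for which all the inequalities are equalities, counts as hyperbolic. **Theorem.** Fix $r\ge 1$, a prime $p$, and $\rho$. The following sequences in $n$ eventually satisfy all higher-order Turán inequalities: - $\alpha_{1,r}(n)$ and $\alpha_{3,p}(pn)$; - $\alpha_{2,p}(w;n)$, for every $w$ with $\gcd(2p,w^2)=1$ (the intersection form is even, so no $w$ in fact meets this condition; the clause is kept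 as in the original); - $\alpha_{2,p}(w;pn)$, for every $w$ with $w^2=2pm$ for some $m\in\mathbb Z$; - $\alpha_{2,p}(w;p^2n)$, for every $w$. -/

import Mathlib

open Polynomial

noncomputable section

namespace VafaWitten

/-! Formal `q`-series with rational exponents: Hahn series in `q` over `ℂ` with exponents in `ℚ`.
The monomial `c * q ^ x` is `HahnSeries.single x c`. -/

abbrev QSeries : Type := HahnSeries ℚ ℂ

open scoped PowerSeries.WithPiTopology in
/-- The Euler product `∏_{n ≥ 1} (1 - q ^ n)` as a formal power series (the product converges
coefficientwise). -/
def eulerProduct : PowerSeries ℂ := ∏' n : ℕ, (1 - PowerSeries.X ^ (n + 1))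

/-- The Dedekind eta function `η(q) = q ^ (1 / 24) * ∏_{n ≥ 1} (1 - q ^ n)` as a `q`-series. -/
def dedekindEta : QSeries := HahnSeries.single (1 / 24 : ℚ) 1 * HahnSeries.ofPowerSeries ℚ ℂ eulerProduct

/-- `η(q) ^ (-24)`, a `q`-series with integral exponents. -/
def etaInv24 : QSeries := (dedekindEta ^ 24)⁻¹

/-- The order embedding `x ↦ s * x` of `ℚ` for `s > 0`. -/
def scaleEmb (s : ℚ) (hs : 0 < s) : ℚ ↪o ℚ :=
  OrderEmbedding.ofStrictMono (fun x => s * x) (fun _ _ h => mul_lt_mul_of_pos_left h hs)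

/-- Multiply the coefficient of `q ^ x` by `e ^ (2 π i t x)`, i.e. substitute `q ↦ e ^ (2 π i t) q`
(for integral exponents `x` this is `q ^ x ↦ (e ^ (2 π i t) * q) ^ x`). -/
def twist (t : ℚ) (F : QSeries) : QSeries where
  coeff x := Complex.exp (2 * Real.pi * Complex.I * t * x) * F.coeff x
  isPWO_support' := F.isPWO_support.mono fun x hx h => hx (by
    change _ * F.coeff x = 0
    rw [h, mul_zero])

/-- The substitution `q ↦ e ^ (2 π i t) * q ^ s` in a `q`-series, for `s > 0`. In terms of the
variable `τ` with `q = e ^ (2 π i τ)` this is `τ ↦ s τ + t`. (Only used for `s > 0`.) -/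
def qSubst (s t : ℚ) (F : QSeries) : QSeries :=
  if hs : 0 < s then HahnSeries.embDomain (scaleEmb s hs) (twist t F) else 0

/-- Gram matrix of the hyperbolic plane `U`. -/
def hyperbolicPlane : Matrix (Fin 2) (Fin 2) ℤ := !![0, 1; 1, 0]

/-- Index set of the standard basis of the K3 lattice (22 elements). -/
abbrev K3Index : Type := (Fin 2 × Fin 3) ⊕ (Fin 8 × Fin 2)

/-- Gram matrix of the K3 lattice `U ⊕ U ⊕ U ⊕ E₈(-1) ⊕ E₈(-1)`, which is the intersection form
on `H²(S, ℤ)` of every complex K3 surface `S`. -/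
def k3Gram : Matrix K3Index K3Index ℤ :=
  Matrix.fromBlocks (Matrix.blockDiagonal fun _ : Fin 3 => hyperbolicPlane) 0 0
    (Matrix.blockDiagonal fun _ : Fin 2 => -CartanMatrix.E₈)

/-- The group `H²(S, ℤ)` of a K3 surface, in coordinates. A class in `H²(S, μ_p)`, which is
`H²(S, ℤ) / p H²(S, ℤ)`, is given by a representative in `H²(S, ℤ)`. -/
abbrev K3Lattice : Type := K3Index → ℤ

/-- The self-intersection number `w² = w · w`. -/
def selfIntersection (w : K3Lattice) : ℤ := dotProduct w (k3Gram.mulVec w)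

open Classical in
/-- `δ_{a,b}`: equal to `1` if `a - b ∈ p H²(S, ℤ)`, and to `0` otherwise. -/
def delta (p : ℕ) (a b : K3Lattice) : ℂ := if ∃ v : K3Lattice, a - b = (p : ℤ) • v then 1 else 0

/-- The partition function `Z^{SU(r)}(q)`:
`∑_{d ∣ r} d / r² * q ^ r * ∑_{j < d} η(ζ_d ^ j q ^ (r / d²)) ^ (-24)`. -/
def Z1 (r : ℕ) : QSeries :=
  ∑ d ∈ r.divisors, HahnSeries.single (r : ℚ) ((d : ℂ) / (r : ℂ) ^ 2) *
    ∑ j ∈ Finset.range d, qSubst ((r : ℚ) / (d : ℚ) ^ 2) ((j : ℚ) / d) etaInv24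

/-- `α_{1,r}(n)`, the coefficient of `q ^ n` in `Z^{SU(r)}(q)`. -/
def alpha1 (r : ℕ) (n : ℤ) : ℂ := (Z1 r).coeff (n : ℚ)

/-- The partition function `Z_w(q)` for `SU(p)/ℤ_p`:
`δ_{w,0} / p² * η(q ^ p) ^ (-24) + 1 / p * ∑_{j < p} e ^ (-π i j w² / p) η(ζ_p ^ j q ^ (1/p)) ^ (-24)`.
-/
def Z2 (p : ℕ) (w : K3Lattice) : QSeries :=
  (delta p w 0 / (p : ℂ) ^ 2) • qSubst (p : ℚ) 0 etaInv24 +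
    (1 / (p : ℂ)) • ∑ j ∈ Finset.range p,
      Complex.exp (-(Real.pi * Complex.I * j * selfIntersection w / p)) •
        qSubst (1 / (p : ℚ)) ((j : ℚ) / p) etaInv24

/-- `α_{2,p}(w; n)`, the coefficient of `q ^ (n / p)` in `Z_w(q)`. -/
def alpha2 (p : ℕ) (w : K3Lattice) (n : ℤ) : ℂ := (Z2 p w).coeff ((n : ℚ) / p)

/-- The twisted partition function `Z_tw^{SU(p)/ℤ_p}(q)` of a K3 surface with Picard number `ρ`:
`q ^ p / p² * η(q ^ p) ^ (-24) + q ^ p * (p ^ 21 * η(q ^ (1/p)) ^ (-24)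
  + p ^ (ρ - 1) * ∑_{1 ≤ j ≤ p - 1} η(ζ_p ^ j q ^ (1/p)) ^ (-24))`. -/
def Z3 (p ρ : ℕ) : QSeries :=
  HahnSeries.single (p : ℚ) (1 / (p : ℂ) ^ 2) * qSubst (p : ℚ) 0 etaInv24 +
    HahnSeries.single (p : ℚ) 1 *
      ((p : ℂ) ^ 21 • qSubst (1 / (p : ℚ)) 0 etaInv24 +
        (p : ℂ) ^ ((ρ : ℤ) - 1) • ∑ j ∈ Finset.Ico 1 p,
          qSubst (1 / (p : ℚ)) ((j : ℚ) / p) etaInv24)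

/-- `α_{3,p}(n)`, the coefficient of `q ^ (n / p)` in `Z_tw^{SU(p)/ℤ_p}(q)`. -/
def alpha3 (p ρ : ℕ) (n : ℤ) : ℂ := (Z3 p ρ).coeff ((n : ℚ) / p)

/-- The Jensen polynomial `J_α^{d,n}(X) = ∑_{j ≤ d} (d choose j) α(n + j) X ^ j`. -/
def jensenPoly (α : ℕ → ℂ) (d n : ℕ) : ℂ[X] :=
  ∑ j ∈ Finset.range (d + 1), C ((d.choose j : ℂ) * α (n + j)) * X ^ j

/-- A polynomial is hyperbolic if it has real coefficients and is a product of linear factors over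
`ℝ`, i.e. all its complex roots are real. The zero polynomial (all Turán inequalities being
equalities) is included. -/
def IsHyperbolic (f : ℂ[X]) : Prop :=
  ∃ g : ℝ[X], g.map (algebraMap ℝ ℂ) = f ∧ g.Splits

/-- As `n → ∞`, the sequence `α` satisfies the Turán inequalities of all orders: for every degree
`d`, the Jensen polynomials `J_α^{d,n}` are hyperbolic for all large `n`. -/
def EventuallyTuran (α : ℕ → ℂ) : Prop :=
  ∀ d : ℕ, ∃ N : ℕ, ∀ n : ℕ, N ≤ n → IsHyperbolic (jensenPoly α d n)

end VafaWitten

end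

open Filter Topology MeasureTheory

namespace VafaWitten

/-! Each sequence is, up to exponentially smaller terms, a positive multiple of the coefficients of
`1/Δ = η^(-24)` along an arithmetic progression, or else vanishes identically, or comes with a
condition that no class meets. The theorem thus rests on one fact: after rescaling, the Jensen
polynomials of such a progression converge to Hermite polynomials.

By Cauchy's formula the coefficient of `q^N` is an integral of `e^(-2πiNτ)/Δ(τ)` over a horizontal
segment of length one. A shift `N ↦ N + Aj` multiplies the integrand by `q^(-Aj)`, so the binomial
theorem collapses the whole Jensen sum into one integral with an extra factor `(1 + X q^(-A))^d`
(`jensen_sum_eq_integral`). Put `N = L^4` and take height `L^(-2)`. The transformation `τ ↦ -1/τ`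
shows that the weight concentrates at scale `x = v/L^3` with Gaussian profile `e^(-2πv²)`. For the
choice `X = rescaledArg A L Y` the extra factor is `L^(-3d) (Y + 2πiAv)^d` to leading order. The
Gaussian average of this power is a Hermite polynomial in `Y` of variance `πA²`
(`gaussianAverage_eq`). Dominated convergence (`tendsto_rescaled_integral`) uses the bound of
`saddleWeight_le`, which joins the modular estimate near the peak to an elementary comparison of
`|∏(1 - q^n)|` with its value on the positive axis.

Hermite polynomials have simple real roots, hence strictly alternating signs at `d + 1` points.
Pointwise convergence at these points passes the signs on to the Jensen polynomials, which are
therefore real-rooted. This needs no convergence of roots, and it tolerates errors of order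
`e^(2π√N)`, the square root of the exponential main term `e^(4π√N)` (`eventuallyTuran_of_approx`).
All secondary terms of the partition functions are within this tolerance, since their exponents are
at most a quarter of the leading one. -/

/-! ### Real-rootedness from alternating signs -/

/-- Exactly the `d - i` factors with `j ≥ i` are negative. -/
theorem prod_sub_sign {d i : ℕ} (hi : i ≤ d) {r : ℕ → ℝ} {t : ℝ} (h1 : ∀ j < i, r j < t)
    (h2 : ∀ j, i ≤ j → j < d → t < r j) :
    0 < (-1 : ℝ) ^ (d - i) * ∏ j ∈ Finset.range d, (t - r j) := by
  induction d, hi using Nat.le_induction with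
  | base =>
    rw [Nat.sub_self, pow_zero, one_mul]
    exact Finset.prod_pos fun j hj => sub_pos.2 (h1 j (Finset.mem_range.1 hj))
  | succ d hd ih =>
    rw [Finset.prod_range_succ, Nat.sub_add_comm hd, pow_succ]
    have := mul_pos (ih fun j hj hj' => h2 j hj (hj'.trans d.lt_succ_self))
      (sub_pos.2 (h2 d hd d.lt_succ_self))
    linarith

/-- A polynomial of degree at most `m` with alternating signs at `m + 1` points is a product of
linear factors whose roots interlace these points. -/
theorem exists_roots_of_sign_changes {P : ℝ[X]} {m : ℕ} (hP : P.natDegree ≤ m) {x : ℕ → ℝ}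
    (hx : StrictMonoOn x (Set.Iic m)) (hs : ∀ i ≤ m, 0 < (-1 : ℝ) ^ (m - i) * P.eval (x i)) :
    ∃ r : ℕ → ℝ, (∀ i < m, x i < r i ∧ r i < x (i + 1)) ∧
      P = C P.leadingCoeff * ∏ j ∈ Finset.range m, (X - C (r j)) := by
  have hroot : ∀ i, ∃ r : ℝ, i < m → (x i < r ∧ r < x (i + 1)) ∧ P.eval r = 0 := by
    intro i
    by_cases hi : i < m
    · have hlt : x i < x (i + 1) := hx (Set.mem_Iic.2 hi.le) (Set.mem_Iic.2 hi) i.lt_succ_self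
      have h0 := hs i hi.le
      have h1 := hs (i + 1) hi
      have hc : ContinuousOn (fun t => (-1 : ℝ) ^ (m - (i + 1)) * P.eval t)
          (Set.Icc (x i) (x (i + 1))) := (continuous_const.mul P.continuous).continuousOn
      rw [show m - i = (m - (i + 1)) + 1 by omega, pow_succ] at h0
      obtain ⟨r, hr, hr'⟩ := intermediate_value_Ioo hlt.le hc
        (Set.mem_Ioo.2 ⟨by linarith, h1⟩)
      exact ⟨r, fun _ => ⟨hr, (mul_eq_zero.1 hr').resolve_left (pow_ne_zero _ (by norm_num))⟩⟩
    · exact ⟨0, fun h => absurd h hi⟩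
  choose r hr using hroot
  refine ⟨r, fun i hi => (hr i hi).1, ?_⟩
  have hP0 : P ≠ 0 := by
    rintro rfl
    simpa using hs 0 (Nat.zero_le _)
  have hmono : ∀ i j, i < j → j < m → r i < r j := fun i j hij hj => by
    refine ((hr i (hij.trans hj)).1.2.trans_le ?_).trans (hr j hj).1.1
    exact hx.monotoneOn (Set.mem_Iic.2 (by omega)) (Set.mem_Iic.2 hj.le) hij
  have hinj : Set.InjOn r (Finset.range m) := by
    intro i hi j hj hij
    simp only [Finset.coe_range, Set.mem_Iio] at hi hj
    rcases lt_trichotomy i j with h | h | h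
    · exact absurd hij (hmono i j h hj).ne
    · exact h
    · exact absurd hij (hmono j i h hi).ne'
  have hsub : (Finset.image r (Finset.range m)).val ≤ P.roots := by
    rw [Finset.val_le_iff_val_subset]
    intro t ht
    obtain ⟨i, hi, rfl⟩ := Finset.mem_image.1 (Finset.mem_def.2 ht)
    exact (mem_roots hP0).2 (hr i (Finset.mem_range.1 hi)).2
  have hcard : Multiset.card (Finset.image r (Finset.range m)).val = m := by
    rw [Finset.card_val, Finset.card_image_of_injOn hinj, Finset.card_range]
  -- The `m` roots found are distinct and the degree is at most `m`, so there are no others and all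
  -- are simple.
  have hroots : (Finset.image r (Finset.range m)).val = P.roots :=
    Multiset.eq_of_le_of_card_le hsub (by rw [hcard]; exact P.card_roots'.trans hP)
  have hdeg : Multiset.card P.roots = P.natDegree := le_antisymm P.card_roots' (by
    rw [← hroots, hcard]; exact hP)
  conv_lhs => rw [← C_leadingCoeff_mul_prod_multiset_X_sub_C hdeg, ← hroots]
  congr 1
  exact Finset.prod_image (f := fun a => X - C a) hinj

theorem splits_of_sign_changes {P : ℝ[X]} {m : ℕ} (hP : P.natDegree ≤ m) {x : ℕ → ℝ}
    (hx : StrictMonoOn x (Set.Iic m)) (hs : ∀ i ≤ m, 0 < (-1 : ℝ) ^ (m - i) * P.eval (x i)) :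
    P.Splits := by
  obtain ⟨r, -, h⟩ := exists_roots_of_sign_changes hP hx hs
  rw [h]
  exact (Splits.C _).mul (Splits.prod fun i _ => Splits.X_sub_C _)

/-! ### Hermite polynomials and interlacing -/

/-- The monic Hermite polynomials for a centred Gaussian of variance `s`. -/
noncomputable def scaledHermite (s : ℝ) : ℕ → ℝ[X]
  | 0 => 1
  | 1 => X
  | d + 2 => X * scaledHermite s (d + 1) - C (s * (d + 1)) * scaledHermite s d

theorem scaledHermite_degree (s : ℝ) : ∀ d, (scaledHermite s d).degree = d ∧
    (scaledHermite s d).Monic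
  | 0 => by simp [scaledHermite]
  | 1 => by simp [scaledHermite, monic_X]
  | d + 2 => by
    have h1 := scaledHermite_degree s (d + 1)
    have h0 := scaledHermite_degree s d
    have hdeg : (X * scaledHermite s (d + 1)).degree = ((d + 2 : ℕ) : WithBot ℕ) := by
      rw [degree_mul, degree_X, h1.1, ← Nat.cast_one, ← Nat.cast_add]
      congr 1
      omega
    have hlt : (C (s * (d + 1)) * scaledHermite s d).degree < (X * scaledHermite s (d + 1)).degree := by
      rw [hdeg]
      refine (degree_mul_le_of_le degree_C_le le_rfl).trans_lt ?_
      rw [h0.1, zero_add]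
      exact_mod_cast (by omega : d < d + 2)
    rw [scaledHermite]
    exact ⟨(degree_sub_eq_left_of_degree_lt hlt).trans hdeg, (monic_X.mul h1.2).sub_of_left hlt⟩

/-- This supplies the two outer nodes in the interlacing induction: the leading term fixes the sign
far out on either side. -/
theorem exists_pos_eval_of_monic {P : ℝ[X]} (hP : P.Monic) (d : ℕ) (hd : P.natDegree = d) (b : ℝ) :
    (∃ t > b, 0 < P.eval t) ∧ ∃ t < b, 0 < (-1 : ℝ) ^ d * P.eval t := by
  have key : ∀ Q : ℝ[X], Q.Monic → ∀ b, ∃ t > b, 0 < Q.eval t := by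
    intro Q hQ b
    rcases eq_or_ne Q 1 with rfl | h1
    · exact ⟨b + 1, by linarith, by simp⟩
    · have := Q.tendsto_atTop_of_leadingCoeff_nonneg (hQ.degree_pos.2 h1) (by rw [hQ]; norm_num)
      obtain ⟨t, ht1, ht2⟩ := ((Filter.eventually_gt_atTop b).and
        (this.eventually_gt_atTop 0)).exists
      exact ⟨t, ht1, ht2⟩
  refine ⟨key P hP b, ?_⟩
  have hQ : (C ((-1 : ℝ) ^ d) * P.comp (-X)).Monic := by
    rw [Monic, leadingCoeff_mul, leadingCoeff_C, leadingCoeff_comp (by simp), hP, hd]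
    simp [← mul_pow]
  obtain ⟨t, ht, h⟩ := key _ hQ (-b)
  exact ⟨-t, by linarith, by simpa using h⟩

/-- Consecutive Hermite polynomials have real, strictly interlacing roots. -/
theorem scaledHermite_interlace {s : ℝ} (hs : 0 < s) (d : ℕ) : ∃ r R : ℕ → ℝ,
    scaledHermite s d = ∏ j ∈ Finset.range d, (X - C (r j)) ∧
    scaledHermite s (d + 1) = ∏ j ∈ Finset.range (d + 1), (X - C (R j)) ∧
    ∀ i < d, R i < r i ∧ r i < R (i + 1) := by
  induction d with
  | zero => exact ⟨0, 0, by simp [scaledHermite], by simp [scaledHermite], by simp⟩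
  | succ d ih =>
    obtain ⟨r, R, hr, hR, hint⟩ := ih
    have hRmono : StrictMonoOn R (Set.Iic d) :=
      strictMonoOn_Iic_of_lt_succ fun i hi => (hint i hi).1.trans (hint i hi).2
    have hdeg := scaledHermite_degree s (d + 2)
    have hnat : (scaledHermite s (d + 2)).natDegree = d + 2 := natDegree_eq_of_degree_eq_some hdeg.1
    have hRroot : ∀ i ≤ d, (scaledHermite s (d + 1)).eval (R i) = 0 := fun i hi => by
      rw [hR, eval_prod]
      exact Finset.prod_eq_zero (Finset.mem_range.2 (Nat.lt_succ_of_le hi)) (by simp)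
    have hsign : ∀ i ≤ d, 0 < (-1 : ℝ) ^ (d - i) * (scaledHermite s d).eval (R i) := fun i hi => by
      rw [hr, eval_prod]
      simp only [eval_sub, eval_X, eval_C]
      refine prod_sub_sign hi (fun j hj => ?_) fun j hj hj' => ?_
      · exact (hint j (by omega)).2.trans_le
          (hRmono.monotoneOn (Set.mem_Iic.2 (by omega)) (Set.mem_Iic.2 hi) hj)
      · exact (hRmono.monotoneOn (Set.mem_Iic.2 hi) (Set.mem_Iic.2 hj'.le) hj).trans_lt
          (hint j hj').1
    obtain ⟨⟨tp, htp, htp'⟩, -⟩ := exists_pos_eval_of_monic hdeg.2 _ hnat (R d)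
    obtain ⟨-, ⟨tm, htm, htm'⟩⟩ := exists_pos_eval_of_monic hdeg.2 _ hnat (R 0)
    -- Nodes for degree `d + 2`: the `d + 1` roots of the preceding polynomial, flanked by a point
    -- far to the left and one far to the right.
    let x : ℕ → ℝ := fun i => if i = 0 then tm else if i ≤ d + 1 then R (i - 1) else tp
    have hx0 : x 0 = tm := by simp [x]
    have hxs : ∀ i ≤ d, x (i + 1) = R i := fun i hi => by simp [x, hi]
    have hxt : x (d + 2) = tp := by simp [x]
    have hx : StrictMonoOn x (Set.Iic (d + 2)) := by
      refine strictMonoOn_Iic_of_lt_succ fun i hi => ?_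
      rcases i with _ | i
      · change x 0 < x (0 + 1)
        rwa [hx0, hxs 0 d.zero_le]
      · rcases (Nat.lt_succ_iff.1 (Nat.succ_lt_succ_iff.1 hi)).eq_or_lt with rfl | h
        · change x (i + 1) < x (i + 2)
          rwa [hxt, hxs i le_rfl]
        · simp only [Order.succ_eq_add_one]
          rw [hxs i h.le, hxs (i + 1) h]
          exact (hint i h).1.trans (hint i h).2
    obtain ⟨R', hR', hprod⟩ := exists_roots_of_sign_changes (P := scaledHermite s (d + 2))
      (m := d + 2) hnat.le hx fun i hi => by
        rcases i with _ | i
        · simpa [hx0] using htm'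
        · rcases (Nat.lt_succ_iff.1 (Nat.lt_succ_of_le hi)).eq_or_lt with h | h
          · obtain rfl : i = d + 1 := by omega
            simpa [hxt] using htp'
          · have hi' : i ≤ d := by omega
            -- At a root of `scaledHermite s (d + 1)` the recurrence leaves only `-s(d + 1)` times
            -- `scaledHermite s d`, whose signs there alternate by interlacing.
            rw [hxs i hi', scaledHermite, eval_sub, eval_mul, eval_mul, hRroot i hi', eval_C,
              show d + 2 - (i + 1) = d - i + 1 by omega, pow_succ]
            have := mul_pos (mul_pos hs (by positivity : (0 : ℝ) < d + 1)) (hsign i hi')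
            linarith
    rw [hdeg.2, C_1, one_mul] at hprod
    refine ⟨R, R', hR, hprod, fun i hi => ⟨?_, ?_⟩⟩
    · simpa [hxs i (by omega)] using (hR' i (by omega)).2
    · simpa [hxs i (by omega)] using (hR' (i + 1) (by omega)).1

theorem scaledHermite_sign_changes {s : ℝ} (hs : 0 < s) (d : ℕ) : ∃ x : ℕ → ℝ,
    StrictMonoOn x (Set.Iic d) ∧
      ∀ i ≤ d, 0 < (-1 : ℝ) ^ (d - i) * (scaledHermite s d).eval (x i) := by
  obtain ⟨r, R, hr, -, hint⟩ := scaledHermite_interlace hs d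
  have hRmono : StrictMonoOn R (Set.Iic d) :=
    strictMonoOn_Iic_of_lt_succ fun i hi => (hint i hi).1.trans (hint i hi).2
  refine ⟨R, hRmono, fun i hi => ?_⟩
  rw [hr, eval_prod]
  simp only [eval_sub, eval_X, eval_C]
  refine prod_sub_sign hi (fun j hj => ?_) fun j hj hj' => ?_
  · exact (hint j (by omega)).2.trans_le
      (hRmono.monotoneOn (Set.mem_Iic.2 (by omega)) (Set.mem_Iic.2 hi) hj)
  · exact (hRmono.monotoneOn (Set.mem_Iic.2 hi) (Set.mem_Iic.2 hj'.le) hj).trans_lt (hint j hj').1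

/-! ### The Euler product as a power series and as a holomorphic function -/

/-- The Taylor series of `f` at `0` as a formal power series. -/
noncomputable def taylorAtZero (f : ℂ → ℂ) : PowerSeries ℂ :=
  PowerSeries.mk fun m => (m.factorial : ℂ)⁻¹ * iteratedDeriv m f 0

theorem taylorAtZero_mul {f g : ℂ → ℂ} (hf : AnalyticAt ℂ f 0) (hg : AnalyticAt ℂ g 0) :
    taylorAtZero (f * g) = taylorAtZero f * taylorAtZero g := by
  ext m
  simp only [taylorAtZero, PowerSeries.coeff_mk, PowerSeries.coeff_mul,
    iteratedDeriv_mul hf.contDiffAt hg.contDiffAt, Finset.mul_sum,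
    Finset.Nat.sum_antidiagonal_eq_sum_range_succ_mk, Nat.succ_eq_add_one]
  refine Finset.sum_congr rfl fun i hi => ?_
  rw [Nat.cast_choose _ (Nat.lt_succ_iff.1 (Finset.mem_range.1 hi))]
  field_simp [Nat.factorial_ne_zero]

theorem taylorAtZero_congr {f g : ℂ → ℂ} (h : f =ᶠ[𝓝 0] g) : taylorAtZero f = taylorAtZero g := by
  ext m
  simp only [taylorAtZero, PowerSeries.coeff_mk, h.iteratedDeriv_eq m]

theorem taylorAtZero_eval (p : ℂ[X]) : taylorAtZero (fun z => p.eval z) = p := by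
  have h : ∀ m, iteratedDeriv m (fun z => p.eval z) = fun z => (derivative^[m] p).eval z := by
    intro m
    induction m with
    | zero => simp
    | succ m ih =>
      rw [iteratedDeriv_succ, ih, Function.iterate_succ_apply']
      ext z
      simp
  ext m
  rw [taylorAtZero, PowerSeries.coeff_mk, h]
  beta_reduce
  rw [← coeff_zero_eq_eval_zero, coeff_iterate_derivative, zero_add, Nat.descFactorial_self, coeff_coe, nsmul_eq_mul,
    inv_mul_cancel_left₀ (by exact_mod_cast m.factorial_ne_zero)]

theorem taylorAtZero_one : taylorAtZero 1 = 1 := by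
  simpa [Pi.one_def] using taylorAtZero_eval 1

theorem taylorAtZero_pow {f : ℂ → ℂ} (hf : AnalyticAt ℂ f 0) (k : ℕ) :
    taylorAtZero (f ^ k) = taylorAtZero f ^ k := by
  induction k with
  | zero => simpa using taylorAtZero_one
  | succ k ih => rw [pow_succ, taylorAtZero_mul (hf.pow k) hf, ih, pow_succ]

/-- Weierstrass: locally uniform limits of holomorphic functions may be differentiated termwise. -/
theorem tendsto_taylorAtZero_coeff {ι : Type*} {l : Filter ι} [l.NeBot] {F : ι → ℂ → ℂ} {f : ℂ → ℂ}
    {U : Set ℂ} (hU : IsOpen U) (h0 : 0 ∈ U) (hF : ∀ i, Differentiable ℂ (F i))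
    (h : TendstoLocallyUniformlyOn F f l U) (m : ℕ) :
    Tendsto (fun i => (taylorAtZero (F i)).coeff m) l (𝓝 ((taylorAtZero f).coeff m)) := by
  have key : ∀ m, TendstoLocallyUniformlyOn (fun i => iteratedDeriv m (F i)) (iteratedDeriv m f) l U := by
    intro m
    induction m with
    | zero => simpa using h
    | succ m ih =>
      simp only [iteratedDeriv_succ]
      refine ih.deriv (Eventually.of_forall fun i => ?_) hU
      exact ((hF i).contDiff (n := ⊤)).differentiable_iteratedDeriv m
        (WithTop.coe_lt_top _) |>.differentiableOn
  simp only [taylorAtZero, PowerSeries.coeff_mk]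
  exact ((key m).tendsto_at h0).const_mul _

/-- The Euler product as a function on the unit disc. -/
noncomputable def eulerFun (z : ℂ) : ℂ := ∏' n : ℕ, (1 - z ^ (n + 1))

-- The finite partial products are polynomials. Their coefficients converge to those of the analytic
-- product by Weierstrass and to those of the formal product by definition, so the limits agree.
open ModularForm PowerSeries.WithPiTopology in
theorem taylorAtZero_eulerFun : taylorAtZero eulerFun = eulerProduct := by
  ext m
  have h1 := tendsto_taylorAtZero_coeff (l := atTop)
    (F := fun (s : Finset ℕ) z => (∏ n ∈ s, (1 - X ^ (n + 1) : ℂ[X])).eval z)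
    (f := eulerFun) (U := Metric.ball 0 1) Metric.isOpen_ball (by simp)
    (fun s => Polynomial.differentiable _) (by
      have := multipliableLocallyUniformlyOn_one_sub_pow.hasProdLocallyUniformlyOn
      have he : eulerFun = fun z => ∏' n : ℕ, (1 - z ^ (n + 1)) := rfl
      simpa [HasProdLocallyUniformlyOn, eval_prod, he] using this) m
  have h2 := ((PowerSeries.WithPiTopology.continuous_coeff ℂ m).tendsto _).comp
    (PowerSeries.WithPiTopology.multipliable_one_sub_X_pow ℂ).hasProd
  refine tendsto_nhds_unique h1 (h2.congr fun s => ?_)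
  rw [Function.comp_apply, taylorAtZero_eval]
  congr 1
  rw [← Polynomial.coeToPowerSeries.ringHom_apply]
  simp [map_prod, Polynomial.coeToPowerSeries.ringHom_apply]

/-- The coefficient of `q ^ k` in `∏ (1 - q ^ n) ^ (-24)`. -/
noncomputable def colorCount (k : ℕ) : ℂ := ((eulerProduct ^ 24)⁻¹).coeff k

theorem differentiableOn_eulerFun : DifferentiableOn ℂ eulerFun (Metric.ball 0 1) :=
  ModularForm.differentiableOn_tprod_one_sub_pow

theorem eulerFun_ne_zero {z : ℂ} (hz : ‖z‖ < 1) : eulerFun z ≠ 0 := by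
  have h := tprod_one_add_ne_zero_of_summable (f := fun n : ℕ => -z ^ (n + 1)) (fun n => ?_) ?_
  · simpa [eulerFun, sub_eq_add_neg] using h
  · rw [← sub_eq_add_neg, sub_ne_zero]
    intro h
    have : ‖z ^ (n + 1)‖ < 1 := by
      rw [norm_pow]
      exact pow_lt_one₀ (norm_nonneg _) hz n.succ_ne_zero
    rw [← h] at this
    simp at this
  · simpa using (summable_nat_add_iff 1).mpr (summable_geometric_of_lt_one (norm_nonneg _) hz)

theorem differentiableOn_eulerFun_inv :
    DifferentiableOn ℂ (fun z => (eulerFun z ^ 24)⁻¹) (Metric.ball 0 1) :=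
  (differentiableOn_eulerFun.fun_pow 24).inv fun z hz =>
    pow_ne_zero _ (eulerFun_ne_zero (by simpa using hz))

theorem taylorAtZero_eulerFun_inv :
    taylorAtZero (fun z => (eulerFun z ^ 24)⁻¹) = (eulerProduct ^ 24)⁻¹ := by
  have hball : Metric.ball (0 : ℂ) 1 ∈ 𝓝 0 := Metric.ball_mem_nhds _ one_pos
  have hf := differentiableOn_eulerFun.analyticAt hball
  have hg := differentiableOn_eulerFun_inv.analyticAt hball
  have h : taylorAtZero (fun z => (eulerFun z ^ 24)⁻¹) * eulerProduct ^ 24 = 1 := by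
    rw [← taylorAtZero_eulerFun, ← taylorAtZero_pow hf, ← taylorAtZero_mul hg (hf.pow 24),
      ← taylorAtZero_one]
    refine taylorAtZero_congr ?_
    filter_upwards [hball] with z hz
    exact inv_mul_cancel₀ (pow_ne_zero _ (eulerFun_ne_zero (by simpa using hz)))
  refine (PowerSeries.eq_inv_iff_mul_eq_one fun h0 => ?_).2 h
  have := congr_arg PowerSeries.constantCoeff h
  rw [map_mul, h0, mul_zero, map_one] at this
  exact zero_ne_one this

/-- By the pentagonal number theorem the Euler product is the image of a real power series with
nonzero constant term, hence so is the inverse of its power. -/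
theorem exists_real_colorCount (k : ℕ) : ∃ b : ℝ, colorCount k = b := by
  have hmap : (PowerSeries.pentagonalSeries ℝ).map Complex.ofRealHom =
      PowerSeries.pentagonalSeries ℂ := by
    ext n
    rw [PowerSeries.coeff_map]
    by_cases hn : n ∈ Set.range pentagonal
    · obtain ⟨j, rfl⟩ := hn
      rw [PowerSeries.coeff_pentagonalSeries_pentagonal,
        PowerSeries.coeff_pentagonalSeries_pentagonal]
      simp
    · rw [PowerSeries.coeff_pentagonalSeries_eq_zero _ hn,
        PowerSeries.coeff_pentagonalSeries_eq_zero _ hn, map_zero]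
  have h0 : PowerSeries.constantCoeff (PowerSeries.pentagonalSeries ℝ) ≠ 0 := by
    rw [← PowerSeries.coeff_zero_eq_constantCoeff_apply, Ne,
      PowerSeries.coeff_pentagonalSeries_eq_zero_iff, not_not]
    exact ⟨0, by simp [pentagonal_def]⟩
  have hE : eulerProduct = (PowerSeries.pentagonalSeries ℝ).map Complex.ofRealHom := by
    rw [hmap, eulerProduct, PowerSeries.WithPiTopology.tprod_one_sub_X_pow]
  refine ⟨((PowerSeries.pentagonalSeries ℝ ^ 24)⁻¹).coeff k, ?_⟩
  have h : ((PowerSeries.pentagonalSeries ℝ ^ 24)⁻¹).map Complex.ofRealHom = (eulerProduct ^ 24)⁻¹ := by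
    rw [PowerSeries.eq_inv_iff_mul_eq_one, hE, ← map_pow, ← map_mul, PowerSeries.inv_mul_cancel,
      map_one]
    · rw [map_pow]
      exact pow_ne_zero _ h0
    · rw [hE, ← map_pow, ← PowerSeries.coeff_zero_eq_constantCoeff_apply, PowerSeries.coeff_map,
        PowerSeries.coeff_zero_eq_constantCoeff_apply, map_pow]
      simpa using h0
  rw [colorCount, ← h, PowerSeries.coeff_map]
  rfl

/-! ### Cauchy's formula on a horizontal line -/

theorem colorCount_eq_circleIntegral (k : ℕ) {R : ℝ} (hR : 0 < R) (hR1 : R < 1) :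
    colorCount k = (2 * Real.pi * Complex.I)⁻¹ *
      ∮ z in C(0, R), (eulerFun z ^ 24)⁻¹ / z ^ (k + 1) := by
  have := (differentiableOn_eulerFun_inv.mono
    (Metric.closedBall_subset_ball hR1)).circleIntegral_one_div_sub_center_pow_smul hR k
  rw [colorCount, ← taylorAtZero_eulerFun_inv, taylorAtZero, PowerSeries.coeff_mk]
  simp only [sub_zero, smul_eq_mul, one_div_mul_eq_div] at this
  rw [this]
  have : (2 * Real.pi * Complex.I : ℂ) ≠ 0 := Complex.two_pi_I_ne_zero
  field_simp

/-- `e ^ (2 π i (x + i y))`. -/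
noncomputable def nome (x y : ℝ) : ℂ := Complex.exp (2 * Real.pi * Complex.I * (x + y * Complex.I))

theorem norm_nome (x y : ℝ) : ‖nome x y‖ = Real.exp (-(2 * Real.pi * y)) := by
  rw [nome, Complex.norm_exp]
  congr 1
  simp

/-- The circle of radius `e^(-2πy)` is parametrised by `x ↦ nome x y`. Periodicity allows the period
to be centred at the saddle point `x = 0`. -/
theorem colorCount_eq_integral (k : ℕ) {y : ℝ} (hy : 0 < y) :
    colorCount k = ∫ x in (-(1 / 2) : ℝ)..(1 / 2),
      (eulerFun (nome x y) ^ 24)⁻¹ * (nome x y ^ k)⁻¹ := by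
  have hR1 : Real.exp (-(2 * Real.pi * y)) < 1 := Real.exp_lt_one_iff.2 (by
    have := Real.pi_pos
    simp only [neg_lt_zero]
    positivity)
  rw [colorCount_eq_circleIntegral k (Real.exp_pos _) hR1, circleIntegral]
  set R := Real.exp (-(2 * Real.pi * y)) with hRdef
  let H : ℝ → ℂ := fun θ => (eulerFun (circleMap 0 R θ) ^ 24)⁻¹ * (circleMap 0 R θ ^ k)⁻¹
  have hR0 : R ≠ 0 := (Real.exp_pos _).ne'
  have h1 : ∀ θ, deriv (circleMap 0 R) θ • ((eulerFun (circleMap 0 R θ) ^ 24)⁻¹ /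
      circleMap 0 R θ ^ (k + 1)) = Complex.I * H θ := by
    intro θ
    have h0 : circleMap 0 R θ ≠ 0 := circleMap_ne_center hR0
    rw [deriv_circleMap, smul_eq_mul]
    simp only [H]
    field_simp
    ring
  have hper : Function.Periodic H (2 * Real.pi) := by
    intro θ
    simp only [H, periodic_circleMap 0 R θ]
  have hnome : ∀ x : ℝ, circleMap 0 R (2 * Real.pi * x) = nome x y := by
    intro x
    rw [circleMap, nome, hRdef, zero_add, Complex.ofReal_exp, ← Complex.exp_add]
    congr 1
    push_cast
    linear_combination -2 * (Real.pi : ℂ) * y * Complex.I_sq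
  simp_rw [h1]
  rw [intervalIntegral.integral_const_mul]
  have h2 : ∫ θ in (0 : ℝ)..2 * Real.pi, H θ = ∫ θ in (-Real.pi)..Real.pi, H θ := by
    have := hper.intervalIntegral_add_eq 0 (-Real.pi)
    rw [zero_add, show -Real.pi + 2 * Real.pi = Real.pi by ring] at this
    exact this
  have h3 := intervalIntegral.integral_comp_mul_left (a := -(1 / 2)) (b := 1 / 2) H
    (c := 2 * Real.pi) (by positivity)
  rw [show 2 * Real.pi * -(1 / 2) = -Real.pi by ring, show 2 * Real.pi * (1 / 2) = Real.pi by ring]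
    at h3
  rw [h2]
  simp only [H, hnome] at h3
  rw [h3]
  simp only [H, Complex.real_smul]
  push_cast
  have : (Real.pi : ℂ) ≠ 0 := by exact_mod_cast Real.pi_ne_zero
  field_simp

/-! ### The modular transformation, and the size of the Euler product off the real axis -/

theorem tendsto_eulerFun_inv :
    Tendsto (fun z => (eulerFun z ^ 24)⁻¹) (𝓝 0) (𝓝 1) := by
  have h := (differentiableOn_eulerFun_inv.differentiableAt
    (Metric.ball_mem_nhds (0 : ℂ) one_pos)).continuousAt.tendsto
  have h0 : eulerFun 0 = 1 := by simp [eulerFun]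
  simpa [h0] using h

open ModularForm UpperHalfPlane in
/-- The modular transformation of `Δ` under `τ ↦ -1/τ`, in terms of the Euler product. -/
theorem nome_mul_eulerFun_transform {x y : ℝ} (hy : 0 < y) :
    nome (-x / (x ^ 2 + y ^ 2)) (y / (x ^ 2 + y ^ 2)) *
      eulerFun (nome (-x / (x ^ 2 + y ^ 2)) (y / (x ^ 2 + y ^ 2))) ^ 24 =
    (x + y * Complex.I) ^ 12 * (nome x y * eulerFun (nome x y) ^ 24) := by
  have hD : ∀ τ : ℍ, discriminant τ = nome τ.re τ.im * eulerFun (nome τ.re τ.im) ^ 24 := by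
    intro τ
    have hq : nome τ.re τ.im = Function.Periodic.qParam 1 τ := by
      rw [nome, Function.Periodic.qParam, ← coe_re, ← coe_im, Complex.re_add_im]
      simp
    have hq1 : ‖Function.Periodic.qParam 1 (τ : ℂ)‖ < 1 := by
      simpa using norm_qParam_lt_one 1 τ
    rw [discriminant_eq_q_prod, hq, eulerFun]
    congr 1
    exact (multipliable_one_sub_pow hq1).tprod_pow 24
  let τ : ℍ := ⟨x + y * Complex.I, by simpa using hy⟩
  have hτ : (τ : ℂ) = x + y * Complex.I := rfl
  have hre : τ.re = x := by simp [τ, UpperHalfPlane.re]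
  have him : τ.im = y := by simp [τ, UpperHalfPlane.im]
  have h := congr_fun discriminant_S_invariant τ
  rw [SL_slash_apply, hD, hD, hre, him] at h
  have hden : denom ModularGroup.S τ = (x + y * Complex.I : ℂ) := by
    rw [ModularGroup.denom_S, hτ]
  have hne : (x + y * Complex.I : ℂ) ≠ 0 := by
    rw [← hτ]
    exact τ.ne_zero
  have hns : Complex.normSq (-(x + y * Complex.I : ℂ)) = x ^ 2 + y ^ 2 := by
    rw [Complex.normSq_neg, Complex.normSq_add_mul_I]
  have hSre : (ModularGroup.S • τ).re = -x / (x ^ 2 + y ^ 2) := by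
    rw [UpperHalfPlane.modular_S_smul, ← coe_re]
    change ((-(τ : ℂ))⁻¹).re = _
    rw [hτ, Complex.inv_re, hns]
    simp
  have hSim : (ModularGroup.S • τ).im = y / (x ^ 2 + y ^ 2) := by
    rw [UpperHalfPlane.modular_S_smul, ← coe_im]
    change ((-(τ : ℂ))⁻¹).im = _
    rw [hτ, Complex.inv_im, hns]
    simp
  rw [hSre, hSim, hden, zpow_neg, mul_inv_eq_iff_eq_mul₀ (zpow_ne_zero _ hne)] at h
  rw [h]
  norm_cast
  ring

/-- Expand `-log|1 - w|` as the sum of `Re(w^n)/n`. Passing from `z` to `‖z‖` increases every term,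
and the gain at `n = 1` alone is `‖z‖ - Re z`. -/
theorem one_sub_mul_exp_le {z : ℂ} (hz : ‖z‖ < 1) :
    ‖(1 - (‖z‖ : ℂ))‖ * Real.exp (‖z‖ - z.re) ≤ ‖1 - z‖ := by
  have hr : ‖(‖z‖ : ℂ)‖ < 1 := by simpa using hz
  have hlog : ∀ w : ℂ, ‖w‖ < 1 → HasSum (fun n : ℕ => ((w ^ n / n).re)) (-Real.log ‖1 - w‖) := by
    intro w hw
    have := Complex.hasSum_re (Complex.hasSum_taylorSeries_neg_log hw)
    simpa [Complex.log_re] using this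
  have hpos : ∀ w : ℂ, ‖w‖ < 1 → 0 < ‖1 - w‖ := by
    intro w hw
    rw [norm_pos_iff, sub_ne_zero]
    rintro rfl
    simp at hw
  have h1 := (hlog _ hr).sub (hlog _ hz)
  have h2 : ∀ n : ℕ, 0 ≤ (((‖z‖ : ℂ) ^ n / n).re) - ((z ^ n / n).re) := by
    intro n
    rw [sub_nonneg]
    refine (Complex.re_le_norm _).trans (le_of_eq ?_)
    rw [← Complex.ofReal_natCast, ← Complex.ofReal_pow, ← Complex.ofReal_div, Complex.ofReal_re]
    simp
  have h3 := le_hasSum h1 1 fun n _ => h2 n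
  simp only [pow_one, Nat.cast_one, div_one, Complex.ofReal_re] at h3
  rw [← Real.exp_log (hpos _ hz), ← Real.exp_log (hpos _ hr), ← Real.exp_add]
  exact Real.exp_le_exp.2 (by linarith)

/-- The preceding inequality is applied to every power `z^(n+1)` and multiplied up; the gains form
the difference of two geometric series. -/
theorem eulerFun_norm_ge {z : ℂ} (hz : ‖z‖ < 1) :
    ‖eulerFun ‖z‖‖ * Real.exp (‖z‖ / (1 - ‖z‖) - (z / (1 - z)).re) ≤ ‖eulerFun z‖ := by
  have hr : ‖(‖z‖ : ℂ)‖ < 1 := by simpa using hz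
  have hgeom : ∀ w : ℂ, ‖w‖ < 1 → HasSum (fun n : ℕ => w ^ (n + 1)) (w / (1 - w)) := by
    intro w hw
    simpa [pow_succ', div_eq_mul_inv] using (hasSum_geometric_of_norm_lt_one hw).mul_left w
  have hsum : HasSum (fun n : ℕ => ‖z‖ ^ (n + 1) - (z ^ (n + 1)).re)
      (‖z‖ / (1 - ‖z‖) - (z / (1 - z)).re) := by
    refine HasSum.sub ?_ (Complex.hasSum_re (hgeom z hz))
    have := Complex.hasSum_re (hgeom _ hr)
    simpa [← Complex.ofReal_pow, ← Complex.ofReal_one, ← Complex.ofReal_sub,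
      ← Complex.ofReal_div] using this
  have hprod : ∀ w : ℂ, ‖w‖ < 1 →
      Tendsto (fun s : Finset ℕ => ∏ n ∈ s, ‖1 - w ^ (n + 1)‖) atTop (𝓝 ‖eulerFun w‖) := by
    intro w hw
    have := (ModularForm.multipliable_one_sub_pow hw).hasProd.norm
    exact this
  refine le_of_tendsto_of_tendsto' ((hprod _ hr).mul
    ((Real.continuous_exp.tendsto _).comp hsum)) (hprod z hz) fun s => ?_
  rw [Function.comp_apply, Real.exp_sum, ← Finset.prod_mul_distrib]
  refine Finset.prod_le_prod (fun n _ => by positivity) fun n _ => ?_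
  have hn : ‖z ^ (n + 1)‖ < 1 := by
    rw [norm_pow]
    exact pow_lt_one₀ (norm_nonneg _) hz n.succ_ne_zero
  simpa using one_sub_mul_exp_le hn

/-- Away from the positive real axis the Euler product is exponentially larger in absolute value
than on it. -/
theorem eulerFun_nome_norm_ge {x y : ℝ} (hy : 0 < y) (hy1 : y ≤ 1 / 14) (hxy : y ≤ |x|)
    (hx : |x| ≤ 1 / 2) :
    ‖eulerFun (nome 0 y)‖ * Real.exp (1 / (24 * Real.pi * y)) ≤ ‖eulerFun (nome x y)‖ := by
  have hπ := Real.pi_pos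
  have hπ3 := Real.pi_gt_three
  have hπ4 := Real.pi_lt_d2
  set r := Real.exp (-(2 * Real.pi * y)) with hr
  have hz : ‖nome x y‖ = r := norm_nome x y
  have hr0 : 0 < r := Real.exp_pos _
  have hr1 : r < 1 := Real.exp_lt_one_iff.2 (by
    simp only [neg_lt_zero]
    positivity)
  have h0 : nome 0 y = (r : ℂ) := by
    rw [nome, hr, Complex.ofReal_exp]
    congr 1
    push_cast
    linear_combination 2 * (Real.pi : ℂ) * y * Complex.I_sq
  have hrlow : 1 - 2 * Real.pi * y ≤ r := by
    have := Real.add_one_le_exp (-(2 * Real.pi * y))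
    linarith
  have hrhalf : 1 / 2 ≤ r := by nlinarith
  have hre : (nome x y).re = r * Real.cos (2 * Real.pi * x) := by
    rw [nome, Complex.exp_re]
    simp [hr]
  -- The bound `cos θ ≤ 1 - 2θ²/π²` on `[-π, π]`.
  have hcos : Real.cos (2 * Real.pi * x) ≤ 1 - 8 * x ^ 2 := by
    have h := Real.cos_le_one_sub_mul_cos_sq (x := 2 * Real.pi * x) (by
      rw [abs_mul, abs_of_pos (by positivity : 0 < 2 * Real.pi)]
      nlinarith)
    have : 2 / Real.pi ^ 2 * (2 * Real.pi * x) ^ 2 = 8 * x ^ 2 := by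
      field_simp
      ring
    rwa [this] at h
  set u := r - (nome x y).re with hu
  have hu4 : 4 * y ^ 2 ≤ u := by
    have hxx : y ^ 2 ≤ x ^ 2 := by
      rw [← sq_abs x]
      exact pow_le_pow_left₀ hy.le hxy 2
    rw [hu, hre]
    nlinarith [sq_nonneg x]
  have hu0 : 0 < u := lt_of_lt_of_le (by positivity) hu4
  have h1r : 0 < 1 - r := by linarith
  have hnsq : Complex.normSq (1 - nome x y) = (1 - r) ^ 2 + 2 * u := by
    have : Complex.normSq (nome x y) = r ^ 2 := by rw [Complex.normSq_eq_norm_sq, hz]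
    rw [Complex.normSq_sub, this]
    simp [hu]
    ring
  have hratio : (nome x y / (1 - nome x y)).re = (r * (1 - r) - u) / ((1 - r) ^ 2 + 2 * u) := by
    have h2 : (nome x y).re ^ 2 + (nome x y).im ^ 2 = r ^ 2 := by
      rw [← hz, ← Complex.normSq_eq_norm_sq, Complex.normSq_apply]
      ring
    rw [Complex.div_re, hnsq, ← add_div]
    congr 1
    simp
    have : (nome x y).re = r - u := by rw [hu]; ring
    nlinarith
  -- After clearing denominators this reduces to `(1 - r)² ≤ 10u`. That holds because `1 - r ≤ 2πy`,
  -- `π² ≤ 10` and `u ≥ 4y²`. The saving left is one sixth of `r/(1 - r)`, and `r/(1 - r)` is at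
  -- least `1/(4πy)`.
  have hbound : (nome x y / (1 - nome x y)).re ≤ 5 / 6 * (r / (1 - r)) := by
    rw [hratio, div_le_iff₀ (by positivity), ← mul_div_assoc, div_mul_eq_mul_div,
      le_div_iff₀ h1r]
    have h10 : (1 - r) ^ 2 ≤ 10 * u := by
      have : (1 - r) ^ 2 ≤ (2 * Real.pi * y) ^ 2 := pow_le_pow_left₀ h1r.le (by linarith) 2
      have hπ2 : Real.pi ^ 2 ≤ 10 := by nlinarith
      nlinarith [mul_le_mul_of_nonneg_right hπ2 (sq_nonneg y)]
    nlinarith [mul_pos hr0 h1r]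
  have hfin : 1 / (24 * Real.pi * y) ≤ ‖nome x y‖ / (1 - ‖nome x y‖) -
      (nome x y / (1 - nome x y)).re := by
    rw [hz]
    have h3 : 1 / (4 * Real.pi * y) ≤ r / (1 - r) := by
      rw [div_le_div_iff₀ (by positivity) h1r]
      nlinarith
    have h4 : 1 / (24 * Real.pi * y) = 1 / 6 * (1 / (4 * Real.pi * y)) := by
      field_simp
      norm_num
    rw [h4]
    linarith
  have hmain := eulerFun_norm_ge (z := nome x y) (by rw [hz]; exact hr1)
  rw [h0, ← hz]
  exact (mul_le_mul_of_nonneg_left (Real.exp_le_exp.2 hfin) (norm_nonneg _)).trans hmain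

/-! ### Saddle-point estimates for the integrand -/

/-- The integrand of the Cauchy integral for the coefficient of `q ^ N` in `1/Δ`, with `N = L ^ 4`,
on the line of height `N ^ (-1/2)`, divided by the size of its peak. -/
noncomputable def saddleWeight (L x : ℝ) : ℂ :=
  (nome x (L ^ 2)⁻¹ * eulerFun (nome x (L ^ 2)⁻¹) ^ 24)⁻¹ *
    Complex.exp (-(2 * Real.pi * Complex.I * L ^ 4 * (x + (L ^ 2)⁻¹ * Complex.I))) *
    (L ^ 24 * Complex.exp (-(4 * Real.pi * L ^ 2)))

/-- With `τ = (t + i)/L²`, the transformation moves `Δ` to `-1/τ`, of height `L²/(1 + t²)`, where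
its Euler product is close to one if `t` is bounded and `L` large. The two exponentials and the
normalisation combine into a single exponent vanishing to second order at `t = 0`. -/
theorem saddleWeight_eq {L : ℝ} (hL : 0 < L) (t : ℝ) :
    saddleWeight L (t / L ^ 2) = (t + Complex.I) ^ 12 *
      Complex.exp (-(2 * Real.pi * L ^ 2 * t ^ 2 / (1 - Complex.I * t))) *
      (eulerFun (nome (-t * L ^ 2 / (1 + t ^ 2)) (L ^ 2 / (1 + t ^ 2))) ^ 24)⁻¹ := by
  have hL' : (L : ℂ) ≠ 0 := by exact_mod_cast hL.ne'
  have hti : (1 + t ^ 2 : ℂ) ≠ 0 := by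
    exact_mod_cast (by positivity : (1 + t ^ 2 : ℝ) ≠ 0)
  have hprod : (1 - Complex.I * t) * (1 + Complex.I * t) = (1 + t ^ 2 : ℂ) := by
    linear_combination -(t : ℂ) ^ 2 * Complex.I_sq
  have h1it : (1 - Complex.I * t : ℂ) ≠ 0 := fun h => hti (by rw [← hprod, h, zero_mul])
  have htI : (t + Complex.I : ℂ) ≠ 0 := by
    intro h
    apply h1it
    linear_combination -Complex.I * h + Complex.I_sq
  have h := nome_mul_eulerFun_transform (x := t / L ^ 2) (y := (L ^ 2)⁻¹) (by positivity)
  rw [show -(t / L ^ 2) / ((t / L ^ 2) ^ 2 + (L ^ 2)⁻¹ ^ 2) = -t * L ^ 2 / (1 + t ^ 2) by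
      field_simp; ring,
    show (L ^ 2)⁻¹ / ((t / L ^ 2) ^ 2 + (L ^ 2)⁻¹ ^ 2) = L ^ 2 / (1 + t ^ 2) by
      field_simp; ring] at h
  have hxy : ((t / L ^ 2 : ℝ) + ((L ^ 2)⁻¹ : ℝ) * Complex.I : ℂ) = (t + Complex.I) / L ^ 2 := by
    push_cast
    field_simp
  rw [hxy] at h
  have h' : (nome (t / L ^ 2) (L ^ 2)⁻¹ * eulerFun (nome (t / L ^ 2) (L ^ 2)⁻¹) ^ 24)⁻¹ =
      ((t + Complex.I) / L ^ 2) ^ 12 *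
      ((nome (-t * L ^ 2 / (1 + t ^ 2)) (L ^ 2 / (1 + t ^ 2)))⁻¹ *
        (eulerFun (nome (-t * L ^ 2 / (1 + t ^ 2)) (L ^ 2 / (1 + t ^ 2))) ^ 24)⁻¹) := by
    rw [← mul_inv, h, mul_inv (((t + Complex.I : ℂ) / L ^ 2) ^ 12), mul_inv_cancel_left₀]
    exact pow_ne_zero _ (div_ne_zero htI (pow_ne_zero _ hL'))
  have hexp : (nome (-t * L ^ 2 / (1 + t ^ 2)) (L ^ 2 / (1 + t ^ 2)))⁻¹ *
      Complex.exp (-(2 * Real.pi * Complex.I * L ^ 4 * ((t / L ^ 2 : ℝ) + (L ^ 2)⁻¹ * Complex.I))) *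
      Complex.exp (-(4 * Real.pi * L ^ 2)) =
      Complex.exp (-(2 * Real.pi * L ^ 2 * t ^ 2 / (1 - Complex.I * t))) := by
    rw [nome, ← Complex.exp_neg, ← Complex.exp_add, ← Complex.exp_add]
    congr 1
    have h3 : (2 * Real.pi * L ^ 2 * t ^ 2 / (1 - Complex.I * t) : ℂ) =
        2 * Real.pi * L ^ 2 * t ^ 2 * (1 + Complex.I * t) / (1 + t ^ 2) := by
      rw [← hprod]
      have : (1 + Complex.I * t : ℂ) ≠ 0 := fun h => hti (by rw [← hprod, h, mul_zero])
      exact (mul_div_mul_right _ _ this).symm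
    rw [h3]
    push_cast
    field_simp
    ring_nf
    simp only [Complex.I_sq]
    ring
  rw [saddleWeight, h', ← hexp, div_pow]
  have : ((L : ℂ) ^ 2) ^ 12 ≠ 0 := pow_ne_zero _ (pow_ne_zero _ hL')
  field_simp

theorem norm_eulerFun_inv_le : ∃ H : ℝ, ∀ x y : ℝ, H ≤ y →
    ‖(eulerFun (nome x y) ^ 24)⁻¹‖ ≤ 2 := by
  have h := tendsto_eulerFun_inv.norm
  rw [norm_one] at h
  have h2 := h.eventually (eventually_le_nhds (by norm_num : (1 : ℝ) < 2))
  obtain ⟨ε, hε, hb⟩ := Metric.eventually_nhds_iff.1 h2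
  have ht : Tendsto (fun y : ℝ => Real.exp (-(2 * Real.pi * y))) atTop (𝓝 0) :=
    Real.tendsto_exp_neg_atTop_nhds_zero.comp
      (tendsto_id.const_mul_atTop (by have := Real.pi_pos; positivity))
  obtain ⟨H, hH⟩ := eventually_atTop.1 (ht.eventually (eventually_lt_nhds hε))
  refine ⟨H, fun x y hy => hb ?_⟩
  rw [dist_zero_right, norm_nome]
  exact hH y hy

/-- The real part of the exponent at the saddle point. -/
theorem re_saddle_exponent (L t : ℝ) :
    (-(2 * Real.pi * L ^ 2 * t ^ 2 / (1 - Complex.I * t)) : ℂ).re =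
      -(2 * Real.pi * L ^ 2 * t ^ 2 / (1 + t ^ 2)) := by
  rw [Complex.neg_re, show (2 * Real.pi * L ^ 2 * t ^ 2 : ℂ) = ((2 * Real.pi * L ^ 2 * t ^ 2 : ℝ) : ℂ) by
    push_cast; rfl, Complex.div_re]
  have : Complex.normSq (1 - Complex.I * t) = 1 + t ^ 2 := by
    rw [Complex.normSq_apply]
    simp
    ring
  rw [this, Complex.ofReal_re, Complex.ofReal_im]
  simp

theorem saddleWeight_major_le : ∃ L₀ : ℝ, 0 < L₀ ∧ ∀ L ≥ L₀, ∀ t : ℝ, |t| ≤ 1 →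
    ‖saddleWeight L (t / L ^ 2)‖ ≤ 2 ^ 13 * Real.exp (-(Real.pi * L ^ 2 * t ^ 2)) := by
  obtain ⟨H, hH⟩ := norm_eulerFun_inv_le
  -- For `|t| ≤ 1` the transformed height is at least `L²/2`, which must exceed `H`.
  refine ⟨max 1 (2 * H), by positivity, fun L hL t ht => ?_⟩
  have hL1 : 1 ≤ L := (le_max_left _ _).trans hL
  have hLH : 2 * H ≤ L := (le_max_right _ _).trans hL
  have ht2 : t ^ 2 ≤ 1 := by rwa [sq_le_one_iff_abs_le_one]
  have hHy : H ≤ L ^ 2 / (1 + t ^ 2) := by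
    rw [le_div_iff₀ (by positivity)]
    nlinarith [sq_nonneg t]
  rw [saddleWeight_eq (by linarith), norm_mul, norm_mul, norm_pow, Complex.norm_exp,
    re_saddle_exponent]
  have h1 : ‖(t + Complex.I : ℂ)‖ ≤ 2 := by
    refine (norm_add_le _ _).trans ?_
    rw [Complex.norm_I, Complex.norm_real, Real.norm_eq_abs]
    linarith
  -- Since `1 + t² ≤ 2`, half of the quadratic decay survives.
  have h2 : Real.exp (-(2 * Real.pi * L ^ 2 * t ^ 2 / (1 + t ^ 2))) ≤
      Real.exp (-(Real.pi * L ^ 2 * t ^ 2)) := by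
    refine Real.exp_le_exp.2 (neg_le_neg ?_)
    rw [le_div_iff₀ (by positivity)]
    have : 0 ≤ Real.pi * L ^ 2 * t ^ 2 := by
      have := Real.pi_pos
      positivity
    nlinarith
  calc _ ≤ 2 ^ 12 * Real.exp (-(Real.pi * L ^ 2 * t ^ 2)) * 2 := by
        gcongr
        exact hH _ _ hHy
    _ = _ := by ring

/-- On a fixed horizontal line only the Euler product varies in absolute value, so the weight is
compared with its value at `x = 0`. The 24th power of the gain `e^(-L²/(24π))` is the factor in the
bound. -/
theorem saddleWeight_minor_le : ∃ L₀ : ℝ, 0 < L₀ ∧ ∀ L ≥ L₀, ∀ x : ℝ, (L ^ 2)⁻¹ ≤ |x| →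
    |x| ≤ 1 / 2 → ‖saddleWeight L x‖ ≤ 2 ^ 13 * Real.exp (-(L ^ 2 / Real.pi)) := by
  obtain ⟨L₀, hL₀, hmaj⟩ := saddleWeight_major_le
  -- The bound `L ≥ 14` ensures `L^(-2) ≤ 1/14`, as the off-axis estimate requires.
  refine ⟨max 14 L₀, by positivity, fun L hL x hx1 hx2 => ?_⟩
  have hL14 : 14 ≤ L := (le_max_left _ _).trans hL
  have hπ := Real.pi_pos
  have hy : 0 < (L ^ 2)⁻¹ := by positivity
  have hy1 : (L ^ 2)⁻¹ ≤ 1 / 14 := by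
    rw [inv_eq_one_div]
    exact one_div_le_one_div_of_le (by norm_num) (by nlinarith)
  have hge := eulerFun_nome_norm_ge hy hy1 hx1 hx2
  have h0 := hmaj L ((le_max_right _ _).trans hL) 0 (by simp)
  rw [zero_div] at h0
  simp only [ne_eq, OfNat.ofNat_ne_zero, not_false_eq_true, zero_pow, mul_zero, neg_zero,
    Real.exp_zero, mul_one] at h0
  have hne : ∀ x : ℝ, 0 < ‖eulerFun (nome x (L ^ 2)⁻¹)‖ := by
    intro x
    refine norm_pos_iff.2 (eulerFun_ne_zero ?_)
    rw [norm_nome]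
    exact Real.exp_lt_one_iff.2 (by simp only [neg_lt_zero]; positivity)
  have hratio : ‖saddleWeight L x‖ = ‖saddleWeight L 0‖ *
      (‖eulerFun (nome 0 (L ^ 2)⁻¹)‖ / ‖eulerFun (nome x (L ^ 2)⁻¹)‖) ^ 24 := by
    have e1 : ∀ x : ℝ, ‖Complex.exp (-(2 * Real.pi * Complex.I * L ^ 4 *
        (x + (L ^ 2)⁻¹ * Complex.I)))‖ = Real.exp (2 * Real.pi * L ^ 4 * (L ^ 2)⁻¹) := by
      intro x
      generalize (L ^ 2)⁻¹ = y
      rw [Complex.norm_exp, show (-(2 * Real.pi * Complex.I * L ^ 4 * (x + y * Complex.I)) : ℂ) =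
        ((2 * Real.pi * L ^ 4 * y : ℝ) : ℂ) + ((-(2 * Real.pi * L ^ 4 * x) : ℝ) : ℂ) * Complex.I by
          push_cast
          linear_combination -(2 * Real.pi * L ^ 4 * y : ℂ) * Complex.I_sq,
        Complex.add_re, Complex.ofReal_re, Complex.re_ofReal_mul, Complex.I_re, mul_zero, add_zero]
    simp only [saddleWeight, norm_mul, norm_inv, norm_pow, e1, norm_nome]
    have hxne := (hne x).ne'
    have h0ne := (hne 0).ne'
    generalize ‖eulerFun (nome x (L ^ 2)⁻¹)‖ = a at hxne ⊢
    generalize ‖eulerFun (nome 0 (L ^ 2)⁻¹)‖ = b at h0ne ⊢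
    field_simp
  have hle : (‖eulerFun (nome 0 (L ^ 2)⁻¹)‖ / ‖eulerFun (nome x (L ^ 2)⁻¹)‖) ^ 24 ≤
      Real.exp (-(L ^ 2 / Real.pi)) := by
    have : ‖eulerFun (nome 0 (L ^ 2)⁻¹)‖ / ‖eulerFun (nome x (L ^ 2)⁻¹)‖ ≤
        Real.exp (-(1 / (24 * Real.pi * (L ^ 2)⁻¹))) := by
      rw [div_le_iff₀ (hne x), Real.exp_neg, ← div_eq_inv_mul, le_div_iff₀ (Real.exp_pos _)]
      exact hge
    refine (pow_le_pow_left₀ (by positivity) this 24).trans (le_of_eq ?_)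
    rw [← Real.exp_nat_mul]
    congr 1
    field_simp
    norm_num
  rw [hratio]
  exact mul_le_mul h0 hle (by positivity) (by positivity)

/-- At `t = v/L` the quantity `L²t²` is constant, so the exponent tends to `-2πv²`; the prefactor
tends to `i^12 = 1`. -/
theorem tendsto_saddleWeight (v : ℝ) :
    Tendsto (fun L : ℝ => saddleWeight L (v / L ^ 3)) atTop
      (𝓝 (Complex.exp (-(2 * Real.pi * v ^ 2)))) := by
  have hdiv : Tendsto (fun L : ℝ => v / L) atTop (𝓝 0) := tendsto_const_nhds.div_atTop tendsto_id
  have hdivc : Tendsto (fun L : ℝ => ((v / L : ℝ) : ℂ)) atTop (𝓝 0) := by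
    exact (Complex.continuous_ofReal.tendsto' 0 0 (by simp)).comp hdiv
  have h1 : Tendsto (fun L : ℝ => (((v / L : ℝ) : ℂ) + Complex.I) ^ 12) atTop (𝓝 1) := by
    have := (hdivc.add_const Complex.I).pow 12
    rwa [zero_add, show Complex.I ^ 12 = 1 by
      rw [show 12 = 4 * 3 by norm_num, pow_mul, Complex.I_pow_four, one_pow]] at this
  have h2 : Tendsto (fun L : ℝ => Complex.exp (-(2 * Real.pi * v ^ 2 /
      (1 - Complex.I * ((v / L : ℝ) : ℂ))))) atTop (𝓝 (Complex.exp (-(2 * Real.pi * v ^ 2)))) := by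
    refine (Complex.continuous_exp.tendsto _).comp (Tendsto.neg ?_)
    have : Tendsto (fun L : ℝ => 1 - Complex.I * ((v / L : ℝ) : ℂ)) atTop (𝓝 1) := by
      simpa using (hdivc.const_mul Complex.I).const_sub 1
    simpa [Pi.div_def] using (tendsto_const_nhds (x := (2 * Real.pi * v ^ 2 : ℂ))).div this one_ne_zero
  have h3 : Tendsto (fun L : ℝ => (eulerFun (nome (-(v / L) * L ^ 2 / (1 + (v / L) ^ 2))
      (L ^ 2 / (1 + (v / L) ^ 2))) ^ 24)⁻¹) atTop (𝓝 1) := by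
    refine tendsto_eulerFun_inv.comp (tendsto_zero_iff_norm_tendsto_zero.2 ?_)
    simp only [norm_nome]
    refine Real.tendsto_exp_neg_atTop_nhds_zero.comp
      (Tendsto.const_mul_atTop (by have := Real.pi_pos; positivity) ?_)
    have hsq : Tendsto (fun L : ℝ => L ^ 2) atTop atTop := tendsto_pow_atTop (by norm_num)
    refine hsq.atTop_mul_pos (C := 1) one_pos ?_
    have := ((hdiv.pow 2).const_add 1).inv₀ (by norm_num)
    simpa using this
  have h := (h1.mul h2).mul h3
  rw [one_mul, mul_one] at h
  refine h.congr' ?_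
  filter_upwards [eventually_gt_atTop 0] with L hL
  have hL' : (L : ℂ) ≠ 0 := by exact_mod_cast hL.ne'
  rw [show v / L ^ 3 = (v / L) / L ^ 2 by field_simp, saddleWeight_eq hL]
  congr 4
  push_cast
  field_simp

theorem exp_neg_sq_mul_pow_le (m : ℕ) (v : ℝ) :
    Real.exp (-(Real.pi * v ^ 2)) * (1 + |v|) ^ m ≤ 2 ^ m * m.factorial * Real.exp 1 := by
  have hπ := Real.pi_gt_three
  have hw : (1 + |v|) ^ m ≤ 2 ^ m * (m.factorial * Real.exp (1 + v ^ 2)) := by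
    have h1 : 1 + |v| ≤ 2 * (1 + v ^ 2) := by
      rw [← sq_abs]
      nlinarith [sq_nonneg (|v| - 1)]
    calc (1 + |v|) ^ m ≤ (2 * (1 + v ^ 2)) ^ m := pow_le_pow_left₀ (by positivity) h1 m
      _ = 2 ^ m * (1 + v ^ 2) ^ m := mul_pow _ _ _
      _ ≤ _ := by
        have := Real.pow_div_factorial_le_exp (x := 1 + v ^ 2) (by positivity) m
        rw [div_le_iff₀ (by positivity)] at this
        gcongr
        linarith
  have he : Real.exp (-(Real.pi * v ^ 2)) ≤ Real.exp (-(v ^ 2)) :=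
    Real.exp_le_exp.2 (by nlinarith [sq_nonneg v])
  calc _ ≤ Real.exp (-(v ^ 2)) * (2 ^ m * (m.factorial * Real.exp (1 + v ^ 2))) := by gcongr
    _ = 2 ^ m * m.factorial * (Real.exp (-(v ^ 2)) * Real.exp (1 + v ^ 2)) := by ring
    _ = _ := by
      rw [← Real.exp_add]
      congr 2
      ring

theorem exp_neg_mul_pow_le (m : ℕ) {L v : ℝ} (hL : 1 ≤ L) (hv : |v| ≤ L ^ 3 / 2) :
    Real.exp (-(L ^ 2 / Real.pi)) * (1 + |v|) ^ m ≤
      2 ^ m * Real.pi ^ (2 * m) * (2 * m).factorial := by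
  have hπ := Real.pi_pos
  have h1 : 1 + |v| ≤ 2 * (L ^ 2) ^ 2 := by
    have h3 : 1 ≤ L ^ 3 := one_le_pow₀ hL
    nlinarith
  have h2 := Real.pow_div_factorial_le_exp (x := L ^ 2 / Real.pi) (by positivity) (2 * m)
  rw [div_le_iff₀ (by positivity), div_pow, div_le_iff₀ (by positivity)] at h2
  have hw : (1 + |v|) ^ m ≤
      2 ^ m * (Real.exp (L ^ 2 / Real.pi) * (2 * m).factorial * Real.pi ^ (2 * m)) := by
    calc (1 + |v|) ^ m ≤ (2 * (L ^ 2) ^ 2) ^ m := pow_le_pow_left₀ (by positivity) h1 m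
      _ = 2 ^ m * (L ^ 2) ^ (2 * m) := by rw [mul_pow, ← pow_mul]
      _ ≤ _ := by gcongr
  calc _ ≤ Real.exp (-(L ^ 2 / Real.pi)) *
        (2 ^ m * (Real.exp (L ^ 2 / Real.pi) * (2 * m).factorial * Real.pi ^ (2 * m))) := by gcongr
    _ = (Real.exp (-(L ^ 2 / Real.pi)) * Real.exp (L ^ 2 / Real.pi)) *
        (2 ^ m * Real.pi ^ (2 * m) * (2 * m).factorial) := by ring
    _ = _ := by rw [← Real.exp_add, neg_add_cancel, Real.exp_zero, one_mul]

/-- A majorant uniform in `L`, with arbitrary polynomial decay, for dominated convergence. The range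
splits at `|v| = L`, that is at `|t| = 1`. Beyond it `1 + |v|` is at most `2L^4`, which the factor
`e^(-L²/π)` absorbs. -/
theorem saddleWeight_le (m : ℕ) : ∃ C L₀ : ℝ, 0 < C ∧ 1 ≤ L₀ ∧ ∀ L ≥ L₀, ∀ v : ℝ, |v| ≤ L ^ 3 / 2 →
    ‖saddleWeight L (v / L ^ 3)‖ * (1 + |v|) ^ m ≤ C := by
  obtain ⟨L₁, hL₁, h1⟩ := saddleWeight_major_le
  obtain ⟨L₂, hL₂, h2⟩ := saddleWeight_minor_le
  have hπ := Real.pi_pos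
  refine ⟨2 ^ 13 * (2 ^ m * m.factorial * Real.exp 1) +
    2 ^ 13 * (2 ^ m * Real.pi ^ (2 * m) * (2 * m).factorial), max 1 (max L₁ L₂), by positivity,
    le_max_left _ _, fun L hL v hv => ?_⟩
  have hL1 : 1 ≤ L := (le_max_left _ _).trans hL
  have hLL₁ : L₁ ≤ L := ((le_max_left _ _).trans (le_max_right _ _)).trans hL
  have hLL₂ : L₂ ≤ L := ((le_max_right _ _).trans (le_max_right _ _)).trans hL
  have hLpos : 0 < L := by linarith
  rcases le_or_gt |v| L with hvL | hvL
  · have ht : |v / L| ≤ 1 := by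
      rw [abs_div, abs_of_pos hLpos, div_le_one hLpos]
      exact hvL
    have h := h1 L hLL₁ (v / L) ht
    rw [show v / L / L ^ 2 = v / L ^ 3 by field_simp,
      show Real.pi * L ^ 2 * (v / L) ^ 2 = Real.pi * v ^ 2 by field_simp] at h
    have hE := exp_neg_sq_mul_pow_le m v
    calc _ ≤ 2 ^ 13 * Real.exp (-(Real.pi * v ^ 2)) * (1 + |v|) ^ m := by gcongr
      _ = 2 ^ 13 * (Real.exp (-(Real.pi * v ^ 2)) * (1 + |v|) ^ m) := by ring
      _ ≤ 2 ^ 13 * (2 ^ m * m.factorial * Real.exp 1) := by gcongr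
      _ ≤ _ := le_add_of_nonneg_right (by positivity)
  · have hx1 : (L ^ 2)⁻¹ ≤ |v / L ^ 3| := by
      rw [abs_div, abs_of_pos (by positivity : 0 < L ^ 3), inv_eq_one_div,
        div_le_div_iff₀ (by positivity) (by positivity)]
      nlinarith [pow_pos hLpos 2]
    have hx2 : |v / L ^ 3| ≤ 1 / 2 := by
      rw [abs_div, abs_of_pos (by positivity : 0 < L ^ 3), div_le_iff₀ (by positivity)]
      linarith
    have h := h2 L hLL₂ _ hx1 hx2
    have hE := exp_neg_mul_pow_le m hL1 hv
    calc _ ≤ 2 ^ 13 * Real.exp (-(L ^ 2 / Real.pi)) * (1 + |v|) ^ m := by gcongr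
      _ = 2 ^ 13 * (Real.exp (-(L ^ 2 / Real.pi)) * (1 + |v|) ^ m) := by ring
      _ ≤ 2 ^ 13 * (2 ^ m * Real.pi ^ (2 * m) * (2 * m).factorial) := by gcongr
      _ ≤ _ := le_add_of_nonneg_left (by positivity)

theorem continuous_saddleWeight {L : ℝ} (hL : 0 < L) : Continuous (saddleWeight L) := by
  have hn : Continuous fun x : ℝ => nome x (L ^ 2)⁻¹ := by
    unfold nome
    fun_prop
  have hlt : ∀ x : ℝ, ‖nome x (L ^ 2)⁻¹‖ < 1 := fun x => by
    rw [norm_nome]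
    refine Real.exp_lt_one_iff.2 ?_
    have := Real.pi_pos
    simp only [neg_lt_zero]
    positivity
  have he : Continuous fun x : ℝ => eulerFun (nome x (L ^ 2)⁻¹) :=
    differentiableOn_eulerFun.continuousOn.comp_continuous hn fun x => by simpa using hlt x
  unfold saddleWeight
  refine ((hn.mul (he.pow 24)).inv₀ fun x => ?_).mul (by fun_prop) |>.mul (by fun_prop)
  exact mul_ne_zero (Complex.exp_ne_zero _) (pow_ne_zero _ (eulerFun_ne_zero (hlt x)))

/-! ### The Gaussian limit and its identification with Hermite polynomials -/

/-- The limiting Gaussian average. -/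
noncomputable def gaussianAverage (A : ℝ) (d : ℕ) (Y : ℝ) : ℂ :=
  ∫ v : ℝ, Complex.exp (-(2 * Real.pi * v ^ 2)) * (Y + 2 * Real.pi * Complex.I * A * v) ^ d

theorem one_add_sq_le (v : ℝ) : 1 + v ^ 2 ≤ (1 + |v|) ^ 2 := by
  rw [← sq_abs v]
  nlinarith [abs_nonneg v]

/-- Convergence of the rescaled Jensen integrals. -/
theorem tendsto_rescaled_integral (A : ℝ) (d : ℕ) (Y : ℝ) :
    Tendsto (fun L : ℝ => ((L : ℂ) ^ 3) ^ (d + 1) * ∫ x in (-(1 / 2) : ℝ)..(1 / 2),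
      saddleWeight L x *
        (1 - (1 - Y / L ^ 3) * Complex.exp (-(2 * Real.pi * Complex.I * A * x))) ^ d) atTop
      (𝓝 (gaussianAverage A d Y)) := by
  -- Substituting `x = v/L³` uses one factor `L³` for the measure and `d` factors to rescale the
  -- `d`th power, whose base has size `L^(-3)`.
  let E : ℝ → ℝ → ℂ := fun L v => Complex.exp (-(2 * Real.pi * Complex.I * A * ((v / L ^ 3 : ℝ) : ℂ)))
  let F : ℝ → ℝ → ℂ := fun L => (Set.Ioc (-(L ^ 3 / 2)) (L ^ 3 / 2)).indicator fun v =>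
    saddleWeight L (v / L ^ 3) * (L ^ 3 * (1 - E L v) + Y * E L v) ^ d
  have hEq : ∀ᶠ L : ℝ in atTop, ∫ v, F L v = ((L : ℂ) ^ 3) ^ (d + 1) *
      ∫ x in (-(1 / 2) : ℝ)..(1 / 2), saddleWeight L x *
        (1 - (1 - Y / L ^ 3) * Complex.exp (-(2 * Real.pi * Complex.I * A * x))) ^ d := by
    filter_upwards [eventually_gt_atTop 0] with L hL
    have hL' : (L : ℂ) ≠ 0 := by exact_mod_cast hL.ne'
    have hL3 : L ^ 3 ≠ 0 := by positivity
    rw [integral_indicator measurableSet_Ioc, ← intervalIntegral.integral_of_le (by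
      have : 0 < L ^ 3 := by positivity
      linarith)]
    have := intervalIntegral.integral_comp_div (a := -(L ^ 3 / 2)) (b := L ^ 3 / 2)
      (fun x => ((L : ℂ) ^ 3) ^ d * (saddleWeight L x *
        (1 - (1 - Y / L ^ 3) * Complex.exp (-(2 * Real.pi * Complex.I * A * x))) ^ d)) hL3
    rw [show -(L ^ 3 / 2) / L ^ 3 = -(1 / 2) by field_simp,
      show L ^ 3 / 2 / L ^ 3 = 1 / 2 by field_simp] at this
    rw [pow_succ ((L : ℂ) ^ 3) d, mul_comm (((L : ℂ) ^ 3) ^ d), mul_assoc,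
      ← intervalIntegral.integral_const_mul, ← Complex.ofReal_pow, ← Complex.real_smul,
      Complex.ofReal_pow, ← this]
    refine intervalIntegral.integral_congr fun v _ => ?_
    simp only [E]
    rw [mul_left_comm, ← mul_pow]
    congr 2
    push_cast
    field_simp
    ring
  refine Tendsto.congr' hEq ?_
  -- Of the `d + 2` powers, `d` control the growth of the integrand and two leave an integrable
  -- majorant.
  obtain ⟨C, L₀, hC, hL₀, hbound⟩ := saddleWeight_le (d + 2)
  set K : ℝ := 2 * Real.pi * |A| + |Y| with hK
  have hπ := Real.pi_pos
  have hK0 : 0 ≤ K := by positivity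
  have hEn : ∀ L v : ℝ, ‖E L v‖ = 1 := fun L v => by
    simp only [E]
    rw [show -(2 * Real.pi * Complex.I * A * ((v / L ^ 3 : ℝ) : ℂ)) =
      ((-(2 * Real.pi * A * (v / L ^ 3)) : ℝ) : ℂ) * Complex.I by push_cast; ring]
    exact Complex.norm_exp_ofReal_mul_I _
  have hE1 : ∀ L v : ℝ, 0 < L → ‖L ^ 3 * (1 - E L v)‖ ≤ 2 * Real.pi * |A| * |v| := fun L v hL => by
    have : ‖E L v - 1‖ ≤ ‖-(2 * Real.pi * A * (v / L ^ 3))‖ := by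
      simp only [E]
      rw [show -(2 * Real.pi * Complex.I * A * ((v / L ^ 3 : ℝ) : ℂ)) =
        Complex.I * ((-(2 * Real.pi * A * (v / L ^ 3)) : ℝ) : ℂ) by push_cast; ring]
      exact Real.norm_exp_I_mul_ofReal_sub_one_le
    rw [norm_mul, norm_sub_rev]
    calc _ ≤ ‖(L : ℂ) ^ 3‖ * ‖-(2 * Real.pi * A * (v / L ^ 3))‖ := by gcongr
      _ = _ := by
        simp only [norm_pow, Complex.norm_real, Real.norm_eq_abs, abs_neg, abs_mul, abs_div,
          abs_pow, abs_of_pos hL, abs_of_pos hπ, abs_two]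
        field_simp
  unfold gaussianAverage
  refine tendsto_integral_filter_of_dominated_convergence (fun v => C * K ^ d * (1 + v ^ 2)⁻¹)
    ?_ ?_ (integrable_inv_one_add_sq.const_mul _) ?_
  · filter_upwards [eventually_gt_atTop 0] with L hL
    refine (Continuous.aestronglyMeasurable ?_).indicator measurableSet_Ioc
    have := (continuous_saddleWeight hL).comp (continuous_id.div_const (L ^ 3))
    refine this.mul ?_
    simp only [E]
    fun_prop
  · filter_upwards [eventually_ge_atTop L₀] with L hL
    refine Eventually.of_forall fun v => ?_
    have hLpos : 0 < L := by linarith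
    by_cases hv : v ∈ Set.Ioc (-(L ^ 3 / 2)) (L ^ 3 / 2)
    · simp only [F]
      rw [Set.indicator_of_mem hv, norm_mul, norm_pow]
      have hv' : |v| ≤ L ^ 3 / 2 := abs_le.2 ⟨hv.1.le, hv.2⟩
      have h2 : ‖L ^ 3 * (1 - E L v) + Y * E L v‖ ≤ K * (1 + |v|) := by
        refine (norm_add_le _ _).trans ?_
        rw [norm_mul (Y : ℂ), hEn, mul_one, Complex.norm_real, Real.norm_eq_abs]
        have := hE1 L v hLpos
        have h3 : 0 ≤ 2 * Real.pi * |A| := by positivity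
        have h4 := abs_nonneg Y
        have h5 := abs_nonneg v
        rw [hK]
        nlinarith [mul_nonneg h4 h5]
      have h1 := hbound L hL v hv'
      have hw : 0 < 1 + |v| := by positivity
      calc _ ≤ ‖saddleWeight L (v / L ^ 3)‖ * (K * (1 + |v|)) ^ d := by gcongr
        _ = (‖saddleWeight L (v / L ^ 3)‖ * (1 + |v|) ^ (d + 2)) * K ^ d * ((1 + |v|) ^ 2)⁻¹ := by
          rw [mul_pow]
          field_simp
          ring
        _ ≤ C * K ^ d * (1 + v ^ 2)⁻¹ := by
          gcongr
          exact one_add_sq_le v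
    · simp only [F]
      rw [Set.indicator_of_notMem hv, norm_zero]
      positivity
  · refine Eventually.of_forall fun v => ?_
    have hcube : Tendsto (fun L : ℝ => L ^ 3) atTop atTop := tendsto_pow_atTop (by norm_num)
    have hinv : Tendsto (fun L : ℝ => (L ^ 3)⁻¹) atTop (𝓝[≠] 0) :=
      (tendsto_inv_atTop_nhdsGT_zero.comp hcube).mono_right
        (nhdsWithin_mono _ fun x hx => (Set.mem_Ioi.1 hx).ne')
    have hE : Tendsto (fun L => E L v) atTop (𝓝 1) := by
      have h0 : Tendsto (fun L : ℝ => v / L ^ 3) atTop (𝓝 0) := tendsto_const_nhds.div_atTop hcube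
      have hc : Continuous fun t : ℝ => Complex.exp (-(2 * Real.pi * Complex.I * A * (t : ℂ))) := by
        fun_prop
      exact (hc.tendsto' 0 1 (by simp)).comp h0
    -- A difference quotient at step `L^(-3)`, converging to minus the derivative of `E` at zero.
    have hslope : Tendsto (fun L : ℝ => L ^ 3 * (1 - E L v)) atTop
        (𝓝 (2 * Real.pi * Complex.I * A * v)) := by
      have hd : HasDerivAt (fun h : ℝ => Complex.exp (-(2 * Real.pi * Complex.I * A * v) * h))
          (-(2 * Real.pi * Complex.I * A * v)) 0 := by
        have h1 : HasDerivAt (fun h : ℝ => -(2 * Real.pi * Complex.I * A * v) * (h : ℂ))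
            (-(2 * Real.pi * Complex.I * A * v)) 0 := by
          simpa using (Complex.ofRealCLM.hasDerivAt (x := (0 : ℝ))).const_mul
            (-(2 * Real.pi * Complex.I * A * v))
        simpa using h1.cexp
      have := (hd.tendsto_slope_zero.comp hinv).neg
      rw [neg_neg] at this
      refine this.congr fun L => ?_
      simp only [Function.comp_apply, E, inv_inv, zero_add, Complex.real_smul, Complex.ofReal_zero,
        mul_zero, Complex.exp_zero]
      rw [← mul_neg, neg_sub]
      push_cast
      congr 3
      ring
    have hmain := (tendsto_saddleWeight v).mul ((hslope.add (hE.const_mul (Y : ℂ))).pow d)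
    rw [mul_one, add_comm _ (Y : ℂ)] at hmain
    refine hmain.congr' ?_
    filter_upwards [hcube.eventually (eventually_gt_atTop (2 * |v|))] with L hL
    have hv : v ∈ Set.Ioc (-(L ^ 3 / 2)) (L ^ 3 / 2) := by
      have h := abs_lt.1 (by linarith : |v| < L ^ 3 / 2)
      exact ⟨h.1, h.2.le⟩
    simp only [F]
    rw [Set.indicator_of_mem hv]

theorem integrable_gaussian_mul {f : ℝ → ℂ} (hf : Continuous f) {K : ℝ} {m : ℕ}
    (hK : ∀ v, ‖f v‖ ≤ K * (1 + |v|) ^ m) :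
    Integrable fun v : ℝ => Complex.exp (-(2 * Real.pi * v ^ 2)) * f v := by
  have hK0 : 0 ≤ K := by simpa using (norm_nonneg _).trans (hK 0)
  refine (integrable_inv_one_add_sq.const_mul
    (2 ^ (m + 2) * (m + 2).factorial * Real.exp 1 * K)).mono'
    (Continuous.aestronglyMeasurable (by fun_prop)) (Eventually.of_forall fun v => ?_)
  have hw : 0 < 1 + |v| := by positivity
  have h1 : ‖Complex.exp (-(2 * Real.pi * v ^ 2))‖ ≤ Real.exp (-(Real.pi * v ^ 2)) := by
    rw [Complex.norm_exp, show (-(2 * Real.pi * v ^ 2) : ℂ) = ((-(2 * Real.pi * v ^ 2) : ℝ) : ℂ) by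
      push_cast; rfl, Complex.ofReal_re]
    refine Real.exp_le_exp.2 ?_
    nlinarith [Real.pi_pos, sq_nonneg v, mul_nonneg Real.pi_pos.le (sq_nonneg v)]
  rw [norm_mul]
  calc _ ≤ Real.exp (-(Real.pi * v ^ 2)) * (K * (1 + |v|) ^ m) := by
        gcongr
        exact hK v
    _ = Real.exp (-(Real.pi * v ^ 2)) * (1 + |v|) ^ (m + 2) * K * ((1 + |v|) ^ 2)⁻¹ := by
        field_simp
        ring
    _ ≤ 2 ^ (m + 2) * (m + 2).factorial * Real.exp 1 * K * (1 + v ^ 2)⁻¹ := by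
        refine mul_le_mul (mul_le_mul_of_nonneg_right (exp_neg_sq_mul_pow_le (m + 2) v) hK0)
          (inv_anti₀ (by positivity) (one_add_sq_le v)) (by positivity) (by positivity)

theorem norm_linear_pow_le (A Y : ℝ) (d : ℕ) (v : ℝ) :
    ‖(Y + 2 * Real.pi * Complex.I * A * v : ℂ) ^ d‖ ≤
      (2 * Real.pi * |A| + |Y|) ^ d * (1 + |v|) ^ d := by
  rw [norm_pow, ← mul_pow]
  refine pow_le_pow_left₀ (norm_nonneg _) ((norm_add_le _ _).trans ?_) d
  simp only [norm_mul, Complex.norm_real, Complex.norm_I, Real.norm_eq_abs, Complex.norm_ofNat,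
    abs_of_pos Real.pi_pos, mul_one]
  nlinarith [mul_nonneg (abs_nonneg Y) (abs_nonneg v),
    mul_nonneg Real.pi_pos.le (abs_nonneg A)]

/-- Gaussian integration by parts: the derivative of `g · l^(d+1)` has integral zero, which turns
the moment with an extra `v` into `(d + 1)(iA/2)` times the average of degree `d`. Multiplied by
`2πiA` this gives `-πA²(d + 1)`. -/
theorem gaussianAverage_succ_succ (A : ℝ) (d : ℕ) (Y : ℝ) :
    gaussianAverage A (d + 2) Y = Y * gaussianAverage A (d + 1) Y -
      Real.pi * A ^ 2 * (d + 1) * gaussianAverage A d Y := by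
  let g : ℝ → ℂ := fun v => Complex.exp (-(2 * Real.pi * v ^ 2))
  let l : ℝ → ℂ := fun v => Y + 2 * Real.pi * Complex.I * A * v
  have hl : Continuous l := by fun_prop
  have hint : ∀ k, Integrable fun v => g v * l v ^ k := fun k =>
    integrable_gaussian_mul (hl.pow k) (norm_linear_pow_le A Y k)
  have hintv : Integrable fun v : ℝ => g v * (v * l v ^ (d + 1)) := by
    refine integrable_gaussian_mul (K := (2 * Real.pi * |A| + |Y|) ^ (d + 1)) (m := d + 2)
      (by fun_prop) fun v => ?_
    rw [norm_mul, Complex.norm_real, Real.norm_eq_abs]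
    have h0 := norm_linear_pow_le A Y (d + 1) v
    have hw : |v| ≤ 1 + |v| := by linarith
    have hπ := Real.pi_pos
    calc _ ≤ (1 + |v|) * ((2 * Real.pi * |A| + |Y|) ^ (d + 1) * (1 + |v|) ^ (d + 1)) := by
          gcongr
      _ = _ := by ring
  have hderiv : ∀ v : ℝ, HasDerivAt (fun v => g v * l v ^ (d + 1))
      (-(4 * Real.pi) * (g v * (v * l v ^ (d + 1))) +
        (d + 1) * (2 * Real.pi * Complex.I * A) * (g v * l v ^ d)) v := by
    intro v
    have hid : HasDerivAt (fun v : ℝ => (v : ℂ)) 1 v := Complex.ofRealCLM.hasDerivAt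
    have hg : HasDerivAt g (Complex.exp (-(2 * Real.pi * v ^ 2)) *
        (-(2 * Real.pi * ((2 : ℕ) * (v : ℂ) ^ (2 - 1) * 1)))) v :=
      (((hid.pow 2).const_mul (2 * Real.pi : ℂ)).neg).cexp
    have hl' : HasDerivAt l (2 * Real.pi * Complex.I * A * 1) v :=
      (hid.const_mul _).const_add _
    refine (hg.mul (hl'.pow (d + 1))).congr_deriv ?_
    simp only [g, Pi.pow_apply]
    push_cast
    ring
  have hzero := integral_eq_zero_of_hasDerivAt_of_integrable hderiv
    ((hintv.const_mul _).add ((hint d).const_mul _)) (hint (d + 1))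
  rw [integral_add (hintv.const_mul _) ((hint d).const_mul _), integral_const_mul,
    integral_const_mul] at hzero
  have hexpand : gaussianAverage A (d + 2) Y = Y * gaussianAverage A (d + 1) Y +
      2 * Real.pi * Complex.I * A * ∫ v : ℝ, g v * (v * l v ^ (d + 1)) := by
    unfold gaussianAverage
    rw [← integral_const_mul, ← integral_const_mul,
      ← integral_add ((hint (d + 1)).const_mul _) (hintv.const_mul _)]
    refine integral_congr_ae (Eventually.of_forall fun v => ?_)
    simp only [g, l]
    ring
  have hd : gaussianAverage A d Y = ∫ v : ℝ, g v * l v ^ d := rfl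
  rw [hexpand, hd]
  have hπ : (Real.pi : ℂ) ≠ 0 := by exact_mod_cast Real.pi_ne_zero
  have hv : ∫ v : ℝ, g v * (v * l v ^ (d + 1)) =
      (d + 1) * (Complex.I * A / 2) * ∫ v : ℝ, g v * l v ^ d := by
    have h4 : (4 * Real.pi : ℂ) ≠ 0 := mul_ne_zero (by norm_num) hπ
    apply mul_left_cancel₀ h4
    linear_combination -hzero
  rw [hv]
  linear_combination (Real.pi * A ^ 2 * (d + 1) * ∫ v : ℝ, g v * l v ^ d) * Complex.I_sq

/-- Both sides satisfy the same three-term recurrence; `√(1/2)` is the total mass of `e^(-2πv²)`. -/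
theorem gaussianAverage_eq (A : ℝ) (Y : ℝ) : ∀ d : ℕ,
    gaussianAverage A d Y =
      ((√(1 / 2) * (scaledHermite (Real.pi * A ^ 2) d).eval Y : ℝ) : ℂ)
  | 0 => by
    have h := integral_gaussian (2 * Real.pi)
    rw [show Real.pi / (2 * Real.pi) = 1 / 2 by field_simp] at h
    rw [gaussianAverage, scaledHermite, eval_one, mul_one, ← h, ← integral_complex_ofReal]
    simp
  | 1 => by
    have h0 := gaussianAverage_eq A Y 0
    have hodd : ∫ v : ℝ, Complex.exp (-(2 * Real.pi * v ^ 2)) * v = 0 := by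
      have h := integral_neg_eq_self (fun v : ℝ => Complex.exp (-(2 * Real.pi * v ^ 2)) * v) volume
      simp only [Complex.ofReal_neg, neg_sq, mul_neg] at h
      rw [integral_neg] at h
      linear_combination -(1 / 2 : ℂ) * h
    have hi0 := integrable_gaussian_mul (f := fun _ => (Y : ℂ)) continuous_const
      (K := |Y|) (m := 0) fun v => by simp
    have hi1 := integrable_gaussian_mul (f := fun v : ℝ => (v : ℂ)) (by fun_prop)
      (K := 1) (m := 1) fun v => by simp
    have : gaussianAverage A 1 Y = Y * gaussianAverage A 0 Y := by
      unfold gaussianAverage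
      simp only [pow_one, pow_zero, mul_one]
      have e : ∀ v : ℝ, Complex.exp (-(2 * Real.pi * v ^ 2)) * (Y + 2 * Real.pi * Complex.I * A * v) =
          Complex.exp (-(2 * Real.pi * v ^ 2)) * Y + (2 * Real.pi * Complex.I * A) *
            (Complex.exp (-(2 * Real.pi * v ^ 2)) * v) := fun v => by ring
      simp_rw [e]
      rw [integral_add hi0 (hi1.const_mul _), integral_const_mul, hodd, mul_zero, add_zero,
        integral_mul_const, mul_comm]
    rw [this, h0]
    simp only [scaledHermite, eval_one, eval_X, mul_one]
    push_cast
    ring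
  | d + 2 => by
    rw [gaussianAverage_succ_succ, gaussianAverage_eq A Y (d + 1), gaussianAverage_eq A Y d,
      scaledHermite]
    simp only [eval_sub, eval_mul, eval_X, eval_C]
    push_cast
    ring

/-! ### Jensen sums as integrals, and the transfer criterion -/

/-- The rescaled argument of the Jensen polynomials. -/
noncomputable def rescaledArg (A L Y : ℝ) : ℝ :=
  -(Real.exp (-(2 * Real.pi * A * (L ^ 2)⁻¹)) * (1 - Y / L ^ 3))

/-- The exponential in `rescaledArg` cancels the absolute value of `q^(-A)` on the line of
integration. Each term of the binomial expansion is then a Cauchy integral; the index is raised by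
one because `1/Δ` starts at `q^(-1)`. -/
theorem jensen_sum_eq_integral (A d N : ℕ) {L : ℝ} (hL : 0 < L) (hN : L ^ 4 = N) (Y : ℝ) :
    (L : ℂ) ^ 24 * Complex.exp (-(4 * Real.pi * L ^ 2)) *
      ∑ j ∈ Finset.range (d + 1), (d.choose j : ℂ) * colorCount (N + A * j + 1) *
        (rescaledArg A L Y : ℂ) ^ j =
    ∫ x in (-(1 / 2) : ℝ)..(1 / 2), saddleWeight L x *
      (1 - (1 - Y / L ^ 3) * Complex.exp (-(2 * Real.pi * Complex.I * (A : ℝ) * x))) ^ d := by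
  have hy : 0 < (L ^ 2)⁻¹ := by positivity
  have hn : Continuous fun x : ℝ => nome x (L ^ 2)⁻¹ := by
    unfold nome
    fun_prop
  have hn0 : ∀ x : ℝ, nome x (L ^ 2)⁻¹ ≠ 0 := fun x => Complex.exp_ne_zero _
  have hNc : (L : ℂ) ^ 4 = N := by exact_mod_cast hN
  have hexp : ∀ x : ℝ, Complex.exp (-(2 * Real.pi * Complex.I * L ^ 4 *
      (x + (L ^ 2)⁻¹ * Complex.I))) = (nome x (L ^ 2)⁻¹ ^ N)⁻¹ := by
    intro x
    rw [nome, ← Complex.exp_nat_mul, ← Complex.exp_neg, hNc]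
    congr 1
    ring
  have hX : ∀ x : ℝ, (rescaledArg A L Y : ℂ) * (nome x (L ^ 2)⁻¹ ^ A)⁻¹ =
      -((1 - Y / L ^ 3) * Complex.exp (-(2 * Real.pi * Complex.I * (A : ℝ) * x))) := by
    intro x
    have : (Real.exp (-(2 * Real.pi * A * (L ^ 2)⁻¹)) : ℂ) * (nome x (L ^ 2)⁻¹ ^ A)⁻¹ =
        Complex.exp (-(2 * Real.pi * Complex.I * (A : ℝ) * x)) := by
      rw [nome, ← Complex.exp_nat_mul, ← Complex.exp_neg, Complex.ofReal_exp, ← Complex.exp_add]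
      congr 1
      push_cast
      linear_combination -(2 * Real.pi * A * ((L : ℂ) ^ 2)⁻¹) * Complex.I_sq
    rw [← this, rescaledArg]
    push_cast
    ring
  have hcont : ∀ j : ℕ, Continuous fun x : ℝ => saddleWeight L x *
      ((d.choose j : ℂ) * (-((1 - Y / L ^ 3) *
        Complex.exp (-(2 * Real.pi * Complex.I * (A : ℝ) * x)))) ^ j) := fun j =>
    (continuous_saddleWeight hL).mul (by fun_prop)
  have hbinom : ∀ x : ℝ, saddleWeight L x * (1 - (1 - Y / L ^ 3) *
      Complex.exp (-(2 * Real.pi * Complex.I * (A : ℝ) * x))) ^ d =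
      ∑ j ∈ Finset.range (d + 1), saddleWeight L x *
      ((d.choose j : ℂ) * (-((1 - Y / L ^ 3) *
        Complex.exp (-(2 * Real.pi * Complex.I * (A : ℝ) * x)))) ^ j) := by
    intro x
    rw [← Finset.mul_sum, sub_eq_neg_add, add_pow]
    congr 1
    refine Finset.sum_congr rfl fun j _ => ?_
    rw [one_pow, mul_one, mul_comm]
  simp_rw [hbinom]
  rw [intervalIntegral.integral_finsetSum fun j _ => (hcont j).intervalIntegrable _ _,
    Finset.mul_sum]
  refine Finset.sum_congr rfl fun j _ => ?_
  have hcomm : ∀ a b i c : ℂ, a * (b * i * c) = a * b * c * i := fun a b i c => by ring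
  rw [colorCount_eq_integral _ hy, hcomm, ← intervalIntegral.integral_const_mul]
  refine intervalIntegral.integral_congr fun x _ => ?_
  rw [← hX, saddleWeight, hexp, mul_pow, inv_pow, ← pow_mul, mul_inv]
  rw [show N + A * j + 1 = 1 + N + A * j by ring, pow_add, pow_add, pow_one, mul_inv, mul_inv]
  ring

theorem fourthRoot_pow {N : ℝ} (hN : 0 ≤ N) : √(√N) ^ 2 = √N ∧ √(√N) ^ 4 = N := by
  have h := Real.sq_sqrt (Real.sqrt_nonneg N)
  exact ⟨h, by rw [show 4 = 2 * 2 by norm_num, pow_mul, h, Real.sq_sqrt hN]⟩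

theorem tendsto_fourthRoot : Tendsto (fun N : ℝ => √(√N)) atTop atTop :=
  Real.tendsto_sqrt_atTop.comp Real.tendsto_sqrt_atTop

/-- This is the limit theorem with `A = d = Y = 0`: the coefficient times `L^27 e^(-4πL²)` tends to
`√(1/2)`. The power of `L` is dropped, and the finitely many small indices go into the constant. -/
theorem exists_colorCount_bound : ∃ C : ℝ, 0 < C ∧ ∀ (k : ℕ) (M : ℝ), (k : ℝ) - 1 ≤ M →
    ‖colorCount k‖ ≤ C * Real.exp (4 * Real.pi * √M) := by
  have h := (tendsto_rescaled_integral (0 : ℕ) 0 0).norm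
  have hlim : ‖gaussianAverage (0 : ℕ) 0 0‖ < 2 := by
    rw [gaussianAverage_eq, scaledHermite, eval_one, mul_one, Complex.norm_real,
      Real.norm_of_nonneg (Real.sqrt_nonneg _), Real.sqrt_lt' (by norm_num)]
    norm_num
  obtain ⟨n₀, hn₀⟩ := eventually_atTop.1 ((tendsto_fourthRoot.comp
    (tendsto_natCast_atTop_atTop (R := ℝ))).eventually
      ((h.eventually (eventually_lt_nhds hlim)).and (eventually_ge_atTop 1)))
  have hπ := Real.pi_pos
  refine ⟨∑ k ∈ Finset.range (n₀ + 1), ‖colorCount k‖ + 2, by positivity, fun k M hM => ?_⟩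
  have hsum : 0 ≤ ∑ k ∈ Finset.range (n₀ + 1), ‖colorCount k‖ := by positivity
  rcases lt_or_ge k (n₀ + 1) with hk | hk
  · have h1 : ‖colorCount k‖ ≤ ∑ k ∈ Finset.range (n₀ + 1), ‖colorCount k‖ :=
      Finset.single_le_sum (f := fun k => ‖colorCount k‖) (fun _ _ => norm_nonneg _)
        (Finset.mem_range.2 hk)
    have h2 : 1 ≤ Real.exp (4 * Real.pi * √M) := Real.one_le_exp (by positivity)
    nlinarith
  · obtain ⟨N, rfl⟩ : ∃ N, k = N + 1 := ⟨k - 1, by omega⟩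
    obtain ⟨h1, h2⟩ := hn₀ N (by omega)
    simp only [Function.comp_apply] at h1 h2
    set L := √(√(N : ℝ)) with hLdef
    obtain ⟨hL2, hL4⟩ := fourthRoot_pow (N := (N : ℝ)) (by positivity)
    rw [← hLdef] at hL2 hL4
    have hLpos : 0 < L := by linarith
    have hJ := jensen_sum_eq_integral 0 0 N hLpos hL4 0
    rw [← hJ] at h1
    simp only [zero_add, Finset.sum_range_one, Nat.choose_self, Nat.cast_one, one_mul, pow_zero,
      mul_one, pow_one, mul_zero, add_zero] at h1
    have hex : ‖Complex.exp (-(4 * Real.pi * L ^ 2))‖ = Real.exp (-(4 * Real.pi * L ^ 2)) := by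
      rw [show (-(4 * Real.pi * L ^ 2) : ℂ) = ((-(4 * Real.pi * L ^ 2) : ℝ) : ℂ) by push_cast; rfl,
        ← Complex.ofReal_exp, Complex.norm_real, Real.norm_of_nonneg (Real.exp_pos _).le]
    rw [norm_mul, norm_mul, norm_mul, hex, norm_pow, norm_pow, Complex.norm_real,
      Real.norm_of_nonneg hLpos.le] at h1
    have h3 : Real.exp (-(4 * Real.pi * L ^ 2)) * ‖colorCount (N + 1)‖ ≤ 2 := by
      refine le_trans ?_ h1.le
      have e3 : 1 ≤ L ^ 3 := one_le_pow₀ h2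
      have e24 : 1 ≤ L ^ 24 := one_le_pow₀ h2
      have e := one_le_mul_of_one_le_of_one_le e3 e24
      have e0 : 0 ≤ Real.exp (-(4 * Real.pi * L ^ 2)) * ‖colorCount (N + 1)‖ := by positivity
      calc _ ≤ (L ^ 3 * L ^ 24) * (Real.exp (-(4 * Real.pi * L ^ 2)) * ‖colorCount (N + 1)‖) :=
            le_mul_of_one_le_left e0 e
        _ = _ := by ring
    have h4 : ‖colorCount (N + 1)‖ ≤ 2 * Real.exp (4 * Real.pi * L ^ 2) := by
      rw [Real.exp_neg, inv_mul_le_iff₀ (Real.exp_pos _)] at h3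
      linarith
    have h5 : Real.exp (4 * Real.pi * L ^ 2) ≤ Real.exp (4 * Real.pi * √M) := by
      rw [hL2]
      push_cast at hM
      gcongr
      linarith
    calc _ ≤ 2 * Real.exp (4 * Real.pi * √M) := by linarith
      _ ≤ _ := by gcongr; linarith

theorem tendsto_pow_mul_exp_neg_sq (m : ℕ) :
    Tendsto (fun L : ℝ => L ^ m * Real.exp (-(2 * Real.pi * L ^ 2))) atTop (𝓝 0) := by
  refine squeeze_zero' ?_ ?_ (Real.tendsto_pow_mul_exp_neg_atTop_nhds_zero m)
  · filter_upwards [eventually_ge_atTop 0] with L hL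
    positivity
  · filter_upwards [eventually_ge_atTop 1] with L hL
    have hπ := Real.pi_gt_three
    gcongr
    nlinarith

/-- A real sequence which is, up to an error of the square root of its size, a positive multiple
of the coefficients of `1/Δ` along an arithmetic progression satisfies the Turán inequalities. -/
theorem eventuallyTuran_of_approx {α : ℕ → ℂ} {A : ℕ} (hA : 0 < A) {B : ℤ} {K C : ℝ} (hK : 0 < K)
    (hC : 0 ≤ C) (hreal : ∀ᶠ n in atTop, (α n).im = 0)
    (happrox : ∀ᶠ n : ℕ in atTop, ‖α n - K * colorCount ((A * n + B + 1 : ℤ).toNat)‖ ≤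
      C * Real.exp (2 * Real.pi * √(A * n + B))) : EventuallyTuran α := by
  intro d
  let N : ℕ → ℝ := fun n => A * n + B
  let L : ℕ → ℝ := fun n => √(√(N n))
  have hπ := Real.pi_pos
  have hNtop : Tendsto N atTop atTop :=
    tendsto_atTop_add_const_right _ _
      ((tendsto_natCast_atTop_atTop (R := ℝ)).const_mul_atTop (by exact_mod_cast hA))
  have hLtop : Tendsto L atTop atTop := tendsto_fourthRoot.comp hNtop
  obtain ⟨n₁, hn₁⟩ := eventually_atTop.1 happrox
  let S : ℝ → ℕ → ℂ := fun Y n => ∑ j ∈ Finset.range (d + 1),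
    (d.choose j : ℂ) * α (n + j) * (rescaledArg A (L n) Y : ℂ) ^ j
  let W : ℕ → ℝ := fun n => (L n ^ 3) ^ (d + 1) * (L n ^ 24 * Real.exp (-(4 * Real.pi * L n ^ 2)))
  have hlim : ∀ Y : ℝ, Tendsto (fun n => (W n : ℂ) * S Y n) atTop
      (𝓝 (K * gaussianAverage (A : ℝ) d Y)) := by
    intro Y
    let M : ℕ → ℂ := fun n => ∑ j ∈ Finset.range (d + 1),
      (d.choose j : ℂ) * colorCount ((A * (n + j : ℕ) + B + 1 : ℤ).toNat) *
        (rescaledArg A (L n) Y : ℂ) ^ j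
    have hmain : Tendsto (fun n => K * ((W n : ℂ) * M n)) atTop
        (𝓝 (K * gaussianAverage (A : ℝ) d Y)) := by
      refine Tendsto.const_mul _ (((tendsto_rescaled_integral A d Y).comp hLtop).congr' ?_)
      filter_upwards [hNtop.eventually (eventually_ge_atTop 1)] with n hn
      have hN0 : (0 : ℤ) ≤ A * n + B := by
        have : (0 : ℝ) ≤ ((A * n + B : ℤ) : ℝ) := by
          push_cast
          change 0 ≤ N n
          linarith
        exact_mod_cast this
      obtain ⟨m, hm⟩ := Int.eq_ofNat_of_zero_le hN0
      have hmN : N n = m := by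
        have : ((A * n + B : ℤ) : ℝ) = m := by rw [hm]; simp
        rw [← this]
        push_cast
        rfl
      have hL4 : L n ^ 4 = m := by rw [← hmN]; exact (fourthRoot_pow (by linarith)).2
      have hLpos : 0 < L n := Real.sqrt_pos.2 (Real.sqrt_pos.2 (by linarith))
      have hM : M n = ∑ j ∈ Finset.range (d + 1), (d.choose j : ℂ) * colorCount (m + A * j + 1) *
          (rescaledArg A (L n) Y : ℂ) ^ j := by
        refine Finset.sum_congr rfl fun j _ => ?_
        have : (A * (n + j : ℕ) + B + 1 : ℤ) = ((m + A * j + 1 : ℕ) : ℤ) := by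
          push_cast
          linear_combination hm
        rw [this, Int.toNat_natCast]
      rw [Function.comp_apply, ← jensen_sum_eq_integral A d m hLpos hL4 Y, ← hM]
      simp only [W]
      push_cast
      ring
    -- The normalisation decays like `e^(-4πL²)` up to powers of `L`, while the error grows like
    -- `e^(2πL²)`. What remains is a power of `L` times `e^(-2πL²)`.
    have herr : Tendsto (fun n => (W n : ℂ) * (S Y n - K * M n)) atTop (𝓝 0) := by
      set D : ℝ := ∑ j ∈ Finset.range (d + 1), (d.choose j : ℝ) *
        (C * Real.exp (2 * Real.pi * √(A * d))) * (1 + |Y|) ^ j with hD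
      have hD0 : Tendsto (fun n => D * (L n ^ (3 * (d + 1) + 24) *
          Real.exp (-(2 * Real.pi * L n ^ 2)))) atTop (𝓝 0) := by
        simpa using ((tendsto_pow_mul_exp_neg_sq (3 * (d + 1) + 24)).comp hLtop).const_mul D
      refine squeeze_zero_norm' ?_ hD0
      filter_upwards [hNtop.eventually (eventually_ge_atTop 1),
        hLtop.eventually (eventually_ge_atTop 1), eventually_ge_atTop n₁] with n hn hL1 hnn
      have hLpos : 0 < L n := by linarith
      have hL2 : L n ^ 2 = √(N n) := (fourthRoot_pow (by linarith)).1
      have hX : ‖(rescaledArg A (L n) Y : ℂ)‖ ≤ 1 + |Y| := by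
        rw [Complex.norm_real, rescaledArg, norm_neg, norm_mul, Real.norm_of_nonneg (Real.exp_pos _).le]
        have e1 : Real.exp (-(2 * Real.pi * A * (L n ^ 2)⁻¹)) ≤ 1 :=
          Real.exp_le_one_iff.2 (by
            rw [neg_nonpos]
            positivity)
        have e2 : ‖1 - Y / L n ^ 3‖ ≤ 1 + |Y| := by
          refine (norm_sub_le _ _).trans ?_
          rw [norm_one, Real.norm_eq_abs, abs_div, abs_of_pos (by positivity : 0 < L n ^ 3)]
          have := div_le_self (abs_nonneg Y) (one_le_pow₀ hL1 (n := 3))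
          linarith
        calc _ ≤ 1 * (1 + |Y|) := mul_le_mul e1 e2 (norm_nonneg _) zero_le_one
          _ = _ := one_mul _
      have hterm : ‖S Y n - K * M n‖ ≤ D * Real.exp (2 * Real.pi * L n ^ 2) := by
        simp only [S, M]
        rw [Finset.mul_sum, ← Finset.sum_sub_distrib, hD, Finset.sum_mul]
        refine norm_sum_le_of_le _ fun j hj => ?_
        have hjd : j ≤ d := Nat.lt_succ_iff.1 (Finset.mem_range.1 hj)
        have h1 := hn₁ (n + j) (by omega)
        -- Subadditivity of the square root, so that the shift by `j ≤ d` costs only a constant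
        -- factor.
        have h2 : √(A * (n + j : ℕ) + B) ≤ L n ^ 2 + √(A * d) := by
          rw [hL2]
          refine Real.sqrt_le_iff.2 ⟨by positivity, ?_⟩
          have e1 := Real.sq_sqrt (by linarith : 0 ≤ N n)
          have e2 := Real.sq_sqrt (by positivity : (0 : ℝ) ≤ A * d)
          have e3 : (A * j : ℝ) ≤ A * d := by gcongr
          have e4 : (A * (n + j : ℕ) + B : ℝ) = N n + A * j := by
            simp only [N]
            push_cast
            ring
          nlinarith [mul_nonneg (Real.sqrt_nonneg (N n)) (Real.sqrt_nonneg (A * d : ℝ))]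
        have h3 : Real.exp (2 * Real.pi * √(A * (n + j : ℕ) + B)) ≤
            Real.exp (2 * Real.pi * √(A * d)) * Real.exp (2 * Real.pi * L n ^ 2) := by
          rw [← Real.exp_add]
          refine Real.exp_le_exp.2 ?_
          nlinarith
        rw [show (d.choose j : ℂ) * α (n + j) * (rescaledArg A (L n) Y : ℂ) ^ j -
          K * ((d.choose j : ℂ) * colorCount ((A * (n + j : ℕ) + B + 1 : ℤ).toNat) *
            (rescaledArg A (L n) Y : ℂ) ^ j) = (d.choose j : ℂ) * (α (n + j) -
              K * colorCount ((A * (n + j : ℕ) + B + 1 : ℤ).toNat)) *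
            (rescaledArg A (L n) Y : ℂ) ^ j by ring, norm_mul, norm_mul, norm_pow,
          Complex.norm_natCast]
        calc _ ≤ (d.choose j : ℝ) * (C * (Real.exp (2 * Real.pi * √(A * d)) *
                Real.exp (2 * Real.pi * L n ^ 2))) * (1 + |Y|) ^ j := by
              gcongr
              exact h1.trans (by gcongr)
          _ = _ := by ring
      rw [norm_mul, Complex.norm_real, Real.norm_of_nonneg (by positivity)]
      calc _ ≤ W n * (D * Real.exp (2 * Real.pi * L n ^ 2)) := by gcongr
        _ = D * (L n ^ (3 * (d + 1) + 24) *
            (Real.exp (-(4 * Real.pi * L n ^ 2)) * Real.exp (2 * Real.pi * L n ^ 2))) := by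
          simp only [W]
          rw [pow_add _ (3 * (d + 1)), pow_mul]
          ring
        _ = _ := by
          rw [← Real.exp_add]
          congr 3
          ring
    have := hmain.add herr
    rw [add_zero] at this
    refine this.congr fun n => ?_
    ring
  have hAR : (0 : ℝ) < A := by exact_mod_cast hA
  obtain ⟨x, hxmono, hxsign⟩ := scaledHermite_sign_changes
    (s := Real.pi * (A : ℝ) ^ 2) (by positivity) d
  have hsign : ∀ i ≤ d, ∀ᶠ n in atTop, 0 < (-1 : ℝ) ^ (d - i) * (S (x i) n).re := by
    intro i hi
    have h := (Complex.continuous_re.tendsto _).comp (hlim (x i))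
    rw [gaussianAverage_eq, ← Complex.ofReal_mul, Complex.ofReal_re] at h
    have h' := h.const_mul ((-1 : ℝ) ^ (d - i))
    have hpos : 0 < (-1 : ℝ) ^ (d - i) * (K * (√(1 / 2) *
        (scaledHermite (Real.pi * (A : ℝ) ^ 2) d).eval (x i))) := by
      have h1 := hxsign i hi
      have h2 : 0 < K * √(1 / 2) := by positivity
      calc 0 < K * √(1 / 2) * ((-1 : ℝ) ^ (d - i) *
            (scaledHermite (Real.pi * (A : ℝ) ^ 2) d).eval (x i)) := mul_pos h2 h1
        _ = _ := by ring
    filter_upwards [h'.eventually (eventually_gt_nhds hpos),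
      hLtop.eventually (eventually_gt_atTop 0)] with n hn hLpos
    rw [Function.comp_apply, Complex.re_ofReal_mul, mul_left_comm] at hn
    exact pos_of_mul_pos_right hn (by positivity)
  -- Only finitely many sample points are involved, so one threshold serves them all.
  have hall : ∀ᶠ n in atTop, ∀ i ∈ Set.Iic d, 0 < (-1 : ℝ) ^ (d - i) * (S (x i) n).re :=
    (eventually_all_finite (Set.finite_Iic d)).2 fun i hi => hsign i hi
  obtain ⟨n₂, hn₂⟩ := eventually_atTop.1 hreal
  obtain ⟨n₃, hn₃⟩ := eventually_atTop.1 (hall.and (hLtop.eventually (eventually_gt_atTop 0)))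
  refine ⟨max n₂ n₃, fun n hn => ?_⟩
  obtain ⟨hs, hLpos⟩ := hn₃ n ((le_max_right _ _).trans hn)
  have hre : ∀ j, α (n + j) = ((α (n + j)).re : ℂ) := fun j => by
    have := hn₂ (n + j) ((le_max_left n₂ n₃).trans (hn.trans (Nat.le_add_right _ _)))
    apply Complex.ext <;> simp [this]
  let g : ℝ[X] := ∑ j ∈ Finset.range (d + 1), Polynomial.C ((d.choose j : ℝ) * (α (n + j)).re) * X ^ j
  refine ⟨g, ?_, ?_⟩
  · simp only [g, jensenPoly, Polynomial.map_sum, Polynomial.map_mul, Polynomial.map_C,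
      Polynomial.map_pow, Polynomial.map_X]
    refine Finset.sum_congr rfl fun j _ => ?_
    rw [hre j]
    simp
  · have hdeg : g.natDegree ≤ d := natDegree_sum_le_of_forall_le _ _ fun j hj =>
      (natDegree_C_mul_X_pow_le _ _).trans (Nat.lt_succ_iff.1 (Finset.mem_range.1 hj))
    -- The map `rescaledArg A (L n)` is increasing and affine in `Y`, so it carries the Hermite
    -- sample points to ordered points for the Jensen polynomial.
    refine splits_of_sign_changes hdeg (x := fun i => rescaledArg A (L n) (x i)) ?_ fun i hi => ?_
    · intro i hi j hj hij
      have := hxmono hi hj hij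
      simp only [rescaledArg]
      have e : 0 < Real.exp (-(2 * Real.pi * A * (L n ^ 2)⁻¹)) := Real.exp_pos _
      have h3 : 0 < L n ^ 3 := by positivity
      have : x i / L n ^ 3 < x j / L n ^ 3 := by gcongr
      nlinarith
    · have heval : (S (x i) n).re = g.eval (rescaledArg A (L n) (x i)) := by
        simp only [S, g, eval_finsetSum, eval_mul, eval_C, eval_pow, eval_X, Complex.re_sum]
        refine Finset.sum_congr rfl fun j _ => ?_
        rw [hre j]
        norm_cast
      rw [← heval]
      exact hs i hi

/-! ### Coefficients of `η^(-24)` and of its substitutions -/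

theorem eulerProduct_pow_mul_inv : eulerProduct ^ 24 * (eulerProduct ^ 24)⁻¹ = 1 := by
  refine PowerSeries.mul_inv_cancel _ ?_
  rw [map_pow, eulerProduct, PowerSeries.WithPiTopology.tprod_one_sub_X_pow]
  refine pow_ne_zero _ ?_
  rw [← PowerSeries.coeff_zero_eq_constantCoeff_apply, Ne,
    PowerSeries.coeff_pentagonalSeries_eq_zero_iff, not_not]
  exact ⟨0, by simp [pentagonal_def]⟩

theorem etaInv24_eq : etaInv24 =
    HahnSeries.single (-1 : ℚ) 1 * HahnSeries.ofPowerSeries ℚ ℂ (eulerProduct ^ 24)⁻¹ := by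
  symm
  refine eq_inv_of_mul_eq_one_left ?_
  rw [dedekindEta, mul_pow, HahnSeries.single_pow, ← map_pow, mul_mul_mul_comm,
    HahnSeries.single_mul_single, ← map_mul, mul_comm _ (eulerProduct ^ 24),
    eulerProduct_pow_mul_inv, map_one, mul_one]
  norm_num

theorem etaInv24_coeff_intCast {m : ℤ} (hm : -1 ≤ m) :
    etaInv24.coeff (m : ℚ) = colorCount (m + 1).toNat := by
  rw [etaInv24_eq, HahnSeries.coeff_single_mul, one_mul, colorCount]
  have : (m : ℚ) - -1 = ((m + 1).toNat : ℚ) := by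
    have h : ((m + 1).toNat : ℤ) = m + 1 := Int.toNat_of_nonneg (by omega)
    have h' : (((m + 1).toNat : ℤ) : ℚ) = ((m + 1 : ℤ) : ℚ) := by rw [h]
    push_cast at h'
    rw [h']
    ring
  rw [this, HahnSeries.ofPowerSeries_apply_coeff]

theorem etaInv24_coeff_eq (x : ℚ) :
    etaInv24.coeff x = 0 ∨ ∃ k : ℕ, (k : ℚ) - 1 = x ∧ etaInv24.coeff x = colorCount k := by
  by_cases h : ∃ k : ℕ, (k : ℚ) - 1 = x
  · obtain ⟨k, rfl⟩ := h
    refine Or.inr ⟨k, rfl, ?_⟩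
    have := etaInv24_coeff_intCast (m := (k : ℤ) - 1) (by omega)
    push_cast at this
    rw [this]
    congr 1
    omega
  · left
    rw [etaInv24_eq, HahnSeries.coeff_single_mul, one_mul, HahnSeries.ofPowerSeries_apply]
    refine HahnSeries.embDomain_of_notMem_range ?_
    rintro ⟨k, hk⟩
    refine h ⟨k, ?_⟩
    change (k : ℚ) = x - -1 at hk
    rw [hk]
    ring

theorem etaInv24_coeff_im (x : ℚ) : (etaInv24.coeff x).im = 0 := by
  rcases etaInv24_coeff_eq x with h | ⟨k, -, h⟩
  · rw [h, Complex.zero_im]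
  · obtain ⟨b, hb⟩ := exists_real_colorCount k
    rw [h, hb, Complex.ofReal_im]

/-- Quartering the exponent halves `4π√N`, which is exactly the error size the transfer criterion
allows. -/
theorem exists_etaInv24_bound : ∃ C : ℝ, 0 < C ∧ ∀ (x : ℚ) (N : ℝ), (x : ℝ) ≤ N / 4 →
    ‖etaInv24.coeff x‖ ≤ C * Real.exp (2 * Real.pi * √N) := by
  obtain ⟨C, hC, hb⟩ := exists_colorCount_bound
  refine ⟨C, hC, fun x N hx => ?_⟩
  have hsqrt : 4 * Real.pi * √(N / 4) = 2 * Real.pi * √N := by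
    rw [Real.sqrt_div' N (by norm_num), show (4 : ℝ) = 2 ^ 2 by norm_num,
      Real.sqrt_sq (by norm_num)]
    ring
  rcases etaInv24_coeff_eq x with h | ⟨k, hk, h⟩
  · rw [h, norm_zero]
    positivity
  · rw [h, ← hsqrt]
    refine hb k _ ?_
    rw [← hk] at hx
    push_cast at hx
    exact hx

theorem qSubst_coeff {s : ℚ} (hs : 0 < s) (t : ℚ) (F : QSeries) (y : ℚ) :
    (qSubst s t F).coeff y =
      Complex.exp (2 * Real.pi * Complex.I * t * (y / s : ℚ)) * F.coeff (y / s) := by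
  rw [qSubst, dif_pos hs]
  have h : y = scaleEmb s hs (y / s) := by
    change y = s * (y / s)
    field_simp
  conv_lhs => rw [h, HahnSeries.embDomain_coeff]
  rfl

/-- Orthogonality of roots of unity. -/
theorem sum_exp_range {d : ℕ} (hd : 0 < d) (m : ℤ) :
    ∑ j ∈ Finset.range d, Complex.exp (2 * Real.pi * Complex.I * m * j / d) =
      if (d : ℤ) ∣ m then (d : ℂ) else 0 := by
  have hd' : (d : ℂ) ≠ 0 := by exact_mod_cast hd.ne'
  have hpow : ∀ j : ℕ, Complex.exp (2 * Real.pi * Complex.I * m * j / d) =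
      Complex.exp (2 * Real.pi * Complex.I * m / d) ^ j := fun j => by
    rw [← Complex.exp_nat_mul]
    congr 1
    ring
  simp_rw [hpow]
  split_ifs with h
  · obtain ⟨k, rfl⟩ := h
    have : Complex.exp (2 * Real.pi * Complex.I * (d * k : ℤ) / d) = 1 := by
      rw [Complex.exp_eq_one_iff]
      refine ⟨k, ?_⟩
      push_cast
      field_simp
    simp only [this, one_pow]
    simp
  · have hne : Complex.exp (2 * Real.pi * Complex.I * m / d) ≠ 1 := by
      rw [Ne, Complex.exp_eq_one_iff]
      rintro ⟨k, hk⟩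
      refine h ⟨k, ?_⟩
      have h2 : (2 * Real.pi * Complex.I : ℂ) ≠ 0 := Complex.two_pi_I_ne_zero
      have h3 : (m : ℂ) = d * k := by
        rw [div_eq_iff hd'] at hk
        apply mul_left_cancel₀ h2
        linear_combination hk
      exact_mod_cast h3
    rw [geom_sum_eq hne, ← Complex.exp_nat_mul,
      show (d : ℂ) * (2 * Real.pi * Complex.I * m / d) = m * (2 * Real.pi * Complex.I) by
        field_simp, Complex.exp_int_mul_two_pi_mul_I, sub_self, zero_div]

theorem exp_int_eq_one {z : ℂ} (m : ℤ) (h : z = 2 * Real.pi * Complex.I * m) : Complex.exp z = 1 := by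
  rw [h, mul_comm, Complex.exp_int_mul_two_pi_mul_I]

open Classical in
/-- The sum over `j` of the twisted series picks out the exponents divisible by `d`. -/
theorem sum_qSubst_coeff {d : ℕ} (hd : 0 < d) {s : ℚ} (hs : 0 < s) (y : ℚ) :
    (∑ j ∈ Finset.range d, qSubst s ((j : ℚ) / d) etaInv24).coeff y =
      (if ∃ k : ℤ, (d * k : ℚ) = y / s then (d : ℂ) else 0) * etaInv24.coeff (y / s) := by
  have hd' : (d : ℂ) ≠ 0 := by exact_mod_cast hd.ne'
  rw [HahnSeries.coeff_sum]
  simp_rw [qSubst_coeff hs]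
  rw [← Finset.sum_mul]
  -- At non-integral exponents the coefficient vanishes, so orthogonality of roots of unity is
  -- needed only at integers.
  rcases etaInv24_coeff_eq (y / s) with h | ⟨k, hk, -⟩
  · rw [h, mul_zero, mul_zero]
  · congr 1
    rw [← hk]
    have h := sum_exp_range hd ((k : ℤ) - 1)
    have e : ∀ j : ℕ, Complex.exp (2 * Real.pi * Complex.I * ((j : ℚ) / d : ℚ) * ((k : ℚ) - 1 : ℚ)) =
        Complex.exp (2 * Real.pi * Complex.I * ((k : ℤ) - 1 : ℤ) * j / d) := fun j => by
      congr 1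
      push_cast
      ring
    simp_rw [e]
    rw [h]
    refine if_congr (exists_congr fun c => ?_) rfl rfl
    constructor
    · intro hc
      exact_mod_cast hc.symm
    · intro hc
      have : (((k : ℤ) - 1 : ℤ) : ℚ) = ((d * c : ℤ) : ℚ) := by
        have hc' : (d * c : ℚ) = (k : ℚ) - 1 := hc
        push_cast
        exact hc'.symm
      exact_mod_cast this

/-! ### Parity of the K3 lattice -/

theorem k3Gram_isSymm : k3Gram.IsSymm := by decide

theorem k3Gram_diag_even (i : K3Index) : ((k3Gram i i : ℤ) : ZMod 2) = 0 := by
  revert i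
  decide

/-- The K3 lattice is even. -/
theorem exists_selfIntersection_eq (w : K3Lattice) : ∃ m : ℤ, selfIntersection w = 2 * m := by
  have h : ((selfIntersection w : ℤ) : ZMod 2) = 0 := by
    have hsum : ((selfIntersection w : ℤ) : ZMod 2) = ∑ x : K3Index × K3Index,
        (w x.1 * (k3Gram x.1 x.2 * w x.2) : ZMod 2) := by
      rw [selfIntersection, Fintype.sum_prod_type]
      simp only [dotProduct, Matrix.mulVec, Finset.mul_sum]
      push_cast
      rfl
    rw [hsum]
    -- Modulo 2 the terms at `(i, j)` and `(j, i)` cancel, and the diagonal terms vanish because the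
    -- diagonal of the Gram matrix is even.
    refine Finset.sum_involution (fun x _ => (x.2, x.1)) (fun x _ => ?_) (fun x _ hx hxx => hx ?_)
      (fun x _ => Finset.mem_univ _) fun x _ => rfl
    · rw [k3Gram_isSymm.apply x.1 x.2]
      linear_combination (w x.1 * (k3Gram x.1 x.2 * w x.2) : ZMod 2) * (CharTwo.two_eq_zero (R := ZMod 2))
    · have : x.2 = x.1 := congr_arg Prod.fst hxx
      rw [this, k3Gram_diag_even]
      ring
  obtain ⟨m, hm⟩ := (ZMod.intCast_zmod_eq_zero_iff_dvd _ 2).1 h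
  exact ⟨m, by exact_mod_cast hm⟩

theorem selfIntersection_smul (c : ℤ) (v : K3Lattice) :
    selfIntersection (c • v) = c ^ 2 * selfIntersection v := by
  rw [selfIntersection, selfIntersection, Matrix.mulVec_smul, smul_dotProduct, dotProduct_smul,
    smul_eq_mul, smul_eq_mul]
  ring

theorem delta_eq_zero_or_one (p : ℕ) (a b : K3Lattice) : delta p a b = 0 ∨ delta p a b = 1 := by
  unfold delta
  split_ifs
  · exact Or.inr rfl
  · exact Or.inl rfl

/-! ### The three families of invariants -/

/-- The divisor `d` contributes the coefficient of `η^(-24)` at `d²(n - r)/r`. The term `d = r`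
leads, with total factor one. Every other divisor is at most `r/2`, so its exponent is at most a
quarter of the leading one. -/
theorem eventuallyTuran_alpha1 {r : ℕ} (hr : 0 < r) : EventuallyTuran fun n => alpha1 r n := by
  classical
  have hr' : (0 : ℚ) < r := by exact_mod_cast hr
  have hrC : (r : ℂ) ≠ 0 := by exact_mod_cast hr.ne'
  let T : ℕ → ℕ → ℂ := fun n d => (d : ℂ) / r ^ 2 *
    ((if ∃ k : ℤ, (d * k : ℚ) = ((n : ℚ) - r) / (r / d ^ 2) then (d : ℂ) else 0) *
      etaInv24.coeff (((n : ℚ) - r) / (r / d ^ 2)))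
  have hcoeff : ∀ n : ℕ, alpha1 r n = ∑ d ∈ r.divisors, T n d := by
    intro n
    rw [alpha1, Z1, HahnSeries.coeff_sum]
    refine Finset.sum_congr rfl fun d hd => ?_
    have hd0 : 0 < d := Nat.pos_of_mem_divisors hd
    have hd' : (0 : ℚ) < d := by exact_mod_cast hd0
    rw [HahnSeries.coeff_single_mul, sum_qSubst_coeff hd0 (by positivity)]
    simp only [T, Int.cast_natCast]
  have hself : ∀ n : ℕ, r ≤ n → T n r = colorCount ((r * n + -(r ^ 2 : ℤ) + 1 : ℤ).toNat) := by
    intro n hn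
    have e : ((n : ℚ) - r) / (r / r ^ 2) = ((r * n + -(r ^ 2 : ℤ) : ℤ) : ℚ) := by
      push_cast
      field_simp
      ring
    have hnn : (r : ℤ) ≤ n := by exact_mod_cast hn
    simp only [T]
    rw [e, etaInv24_coeff_intCast (by nlinarith), if_pos ⟨(n : ℤ) - r, by push_cast; ring⟩]
    field_simp
  obtain ⟨C, hC, hbound⟩ := exists_etaInv24_bound
  refine eventuallyTuran_of_approx (A := r) hr (B := -(r ^ 2 : ℤ)) (K := 1)
    (C := ∑ d ∈ r.divisors.erase r, C) one_pos (by positivity)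
    (Eventually.of_forall fun n => ?_) ?_
  · rw [hcoeff, Complex.im_sum]
    refine Finset.sum_eq_zero fun d _ => ?_
    have h1 : (d : ℂ) / r ^ 2 = ((d / r ^ 2 : ℝ) : ℂ) := by push_cast; rfl
    simp only [T]
    rw [h1, Complex.im_ofReal_mul]
    split_ifs
    · rw [← Complex.ofReal_natCast, Complex.im_ofReal_mul, etaInv24_coeff_im, mul_zero, mul_zero]
    · rw [zero_mul, Complex.zero_im, mul_zero]
  · filter_upwards [eventually_ge_atTop r] with n hn
    rw [hcoeff, ← Finset.add_sum_erase _ _ (Nat.mem_divisors_self r hr.ne'), hself n hn,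
      Complex.ofReal_one, one_mul, add_sub_cancel_left, Finset.sum_mul]
    refine norm_sum_le_of_le _ fun d hd => ?_
    obtain ⟨hdr, hd⟩ := Finset.mem_erase.1 hd
    have hd0 : 0 < d := Nat.pos_of_mem_divisors hd
    have hdR : (0 : ℝ) < d := by exact_mod_cast hd0
    have hrR : (0 : ℝ) < r := by exact_mod_cast hr
    obtain ⟨c, hc⟩ := Nat.dvd_of_mem_divisors hd
    have hc2 : 2 ≤ c := by
      rcases c with _ | _ | c
      · omega
      · exact absurd (by simpa using hc.symm) hdr
      · omega
    have h2d : 2 * (d : ℝ) ≤ r := by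
      have : 2 * d ≤ r := by
        rw [hc, mul_comm]
        exact Nat.mul_le_mul_left d hc2
      exact_mod_cast this
    have hnr : (r : ℝ) ≤ n := by exact_mod_cast hn
    have hb := hbound (((n : ℚ) - r) / (r / d ^ 2)) (r * n + (-(r ^ 2 : ℤ) : ℤ)) (by
      push_cast
      rw [div_div_eq_mul_div, div_le_div_iff₀ hrR (by norm_num)]
      have h4 : (d : ℝ) ^ 2 * 4 ≤ r ^ 2 := by nlinarith
      nlinarith [mul_le_mul_of_nonneg_left h4 (sub_nonneg.2 hnr)])
    have hcoef : ‖(d : ℂ) / r ^ 2‖ * d ≤ 1 := by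
      rw [norm_div, norm_pow, Complex.norm_natCast, Complex.norm_natCast, div_mul_eq_mul_div,
        div_le_one (by positivity)]
      nlinarith
    simp only [T]
    rw [norm_mul, norm_mul]
    have hif : ‖(if ∃ k : ℤ, (d * k : ℚ) = ((n : ℚ) - r) / (r / d ^ 2) then (d : ℂ) else 0)‖ ≤ d := by
      split_ifs
      · rw [Complex.norm_natCast]
      · rw [norm_zero]
        exact hdR.le
    refine le_trans ?_ hb
    calc _ ≤ ‖(d : ℂ) / r ^ 2‖ * (d * ‖etaInv24.coeff (((n : ℚ) - r) / (r / d ^ 2))‖) := by gcongr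
      _ = ‖(d : ℂ) / r ^ 2‖ * d * ‖etaInv24.coeff (((n : ℚ) - r) / (r / d ^ 2))‖ := by ring
      _ ≤ 1 * ‖etaInv24.coeff (((n : ℚ) - r) / (r / d ^ 2))‖ := by gcongr
      _ = _ := one_mul _

/-- At indices divisible by `p` all the phases are trivial, so the terms in `q^(1/p)` add up to the
positive multiple `K` of one coefficient. The remaining term has exponent smaller by the factor `p²
≥ 4`. -/
theorem eventuallyTuran_alpha3 {p : ℕ} (hp : p.Prime) (ρ : ℕ) :
    EventuallyTuran fun n => alpha3 p ρ ((p : ℤ) * n) := by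
  have hp0 : 0 < p := hp.pos
  have hpQ : (0 : ℚ) < p := by exact_mod_cast hp0
  have hpR : (0 : ℝ) < p := by exact_mod_cast hp0
  have hp2 : (2 : ℝ) ≤ p := by exact_mod_cast hp.two_le
  have hpC : (p : ℂ) ≠ 0 := by exact_mod_cast hp0.ne'
  let K : ℝ := (p : ℝ) ^ 21 + (p : ℝ) ^ ((ρ : ℤ) - 1) * ((p - 1 : ℕ) : ℝ)
  have hcoeff : ∀ n : ℕ, alpha3 p ρ ((p : ℤ) * n) =
      ((1 / (p : ℝ) ^ 2 : ℝ) : ℂ) * etaInv24.coeff (((n : ℚ) - p) / p) +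
        K * etaInv24.coeff ((p * n + -(p ^ 2 : ℤ) : ℤ) : ℚ) := by
    intro n
    have e1 : (((p : ℤ) * n : ℤ) : ℚ) / p - p = n - p := by
      push_cast
      field_simp
    have e2 : ((n : ℚ) - p) / (1 / p) = ((p * n + -(p ^ 2 : ℤ) : ℤ) : ℚ) := by
      push_cast
      field_simp
      ring
    rw [alpha3, Z3, HahnSeries.coeff_add, HahnSeries.coeff_single_mul, HahnSeries.coeff_single_mul,
      HahnSeries.coeff_add, HahnSeries.coeff_smul, HahnSeries.coeff_smul, HahnSeries.coeff_sum, e1,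
      qSubst_coeff hpQ, qSubst_coeff (by positivity), one_mul, smul_eq_mul, smul_eq_mul]
    have hterm : ∀ j ∈ Finset.Ico 1 p, (qSubst (1 / (p : ℚ)) ((j : ℚ) / p) etaInv24).coeff (n - p) =
        etaInv24.coeff ((p * n + -(p ^ 2 : ℤ) : ℤ) : ℚ) := by
      intro j _
      rw [qSubst_coeff (by positivity), e2, exp_int_eq_one ((j : ℤ) * (n - p)), one_mul]
      push_cast
      field_simp
      ring
    rw [Finset.sum_congr rfl hterm, Finset.sum_const, Nat.card_Ico, e2]
    simp only [Rat.cast_zero, mul_zero, zero_mul, Complex.exp_zero, one_mul, nsmul_eq_mul, K]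
    push_cast
    ring
  have hK : 0 < K := by positivity
  obtain ⟨C, hC, hbound⟩ := exists_etaInv24_bound
  refine eventuallyTuran_of_approx (A := p) hp0 (B := -(p ^ 2 : ℤ)) (K := K) (C := C) hK hC.le
    (Eventually.of_forall fun n => ?_) ?_
  · rw [hcoeff, Complex.add_im, Complex.im_ofReal_mul, Complex.im_ofReal_mul, etaInv24_coeff_im,
      etaInv24_coeff_im, mul_zero, mul_zero, add_zero]
  · filter_upwards [eventually_ge_atTop p] with n hn
    have hnn : (p : ℤ) ≤ n := by exact_mod_cast hn
    have hnR : (p : ℝ) ≤ n := by exact_mod_cast hn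
    rw [hcoeff, etaInv24_coeff_intCast (m := p * n + -(p ^ 2 : ℤ)) (by nlinarith),
      add_sub_cancel_right, norm_mul, Complex.norm_real]
    have hb := hbound (((n : ℚ) - p) / p) (p * n + (-(p ^ 2 : ℤ) : ℤ)) (by
      push_cast
      rw [div_le_div_iff₀ hpR (by norm_num)]
      have h4 : (4 : ℝ) ≤ p ^ 2 := by nlinarith
      nlinarith [mul_le_mul_of_nonneg_left h4 (sub_nonneg.2 hnR)])
    have h1 : ‖1 / (p : ℝ) ^ 2‖ ≤ 1 := by
      rw [Real.norm_of_nonneg (by positivity), div_le_one (by positivity)]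
      nlinarith
    exact (mul_le_of_le_one_left (norm_nonneg _) h1).trans hb

/-- The coefficients of `Z_w` as coefficients of `η ^ (-24)`. -/
theorem alpha2_eq {p : ℕ} (hp : 0 < p) (w : K3Lattice) {m : ℤ} (hm : selfIntersection w = 2 * m)
    (n : ℤ) : alpha2 p w (p * n) =
      delta p w 0 / (p : ℂ) ^ 2 * etaInv24.coeff ((n : ℚ) / p) +
        (if (p : ℤ) ∣ m then 1 else 0) * etaInv24.coeff ((p * n : ℤ) : ℚ) := by
  have hpQ : (0 : ℚ) < p := by exact_mod_cast hp
  have hpC : (p : ℂ) ≠ 0 := by exact_mod_cast hp.ne'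
  have e1 : ((p * n : ℤ) : ℚ) / p = n := by
    push_cast
    field_simp
  have e2 : (n : ℚ) / (1 / p) = ((p * n : ℤ) : ℚ) := by
    push_cast
    field_simp
  rw [alpha2, Z2, HahnSeries.coeff_add, HahnSeries.coeff_smul, HahnSeries.coeff_smul,
    HahnSeries.coeff_sum, e1, qSubst_coeff hpQ, smul_eq_mul, smul_eq_mul]
  have hterm : ∀ j ∈ Finset.range p, (Complex.exp (-(Real.pi * Complex.I * j * selfIntersection w / p)) •
      qSubst (1 / (p : ℚ)) ((j : ℚ) / p) etaInv24).coeff (n : ℚ) =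
      Complex.exp (2 * Real.pi * Complex.I * (-m : ℤ) * j / p) *
        etaInv24.coeff ((p * n : ℤ) : ℚ) := by
    intro j _
    have h1 : Complex.exp (2 * Real.pi * Complex.I * ((j : ℚ) / p : ℚ) * ((p * n : ℤ) : ℚ)) = 1 :=
      exp_int_eq_one ((j : ℤ) * n) (by
        push_cast
        field_simp)
    rw [HahnSeries.coeff_smul, smul_eq_mul, qSubst_coeff (by positivity), e2, h1, one_mul, hm]
    congr 2
    push_cast
    ring
  -- The phases of the substitution are trivial at these exponents, so what is left is the character
  -- sum in `w²`, which detects whether `p` divides `w²/2`.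
  rw [Finset.sum_congr rfl hterm, ← Finset.sum_mul, sum_exp_range hp]
  simp only [dvd_neg, Rat.cast_zero, mul_zero, zero_mul, Complex.exp_zero, one_mul]
  split_ifs
  · field_simp
  · simp

theorem delta_div_im (p : ℕ) (w : K3Lattice) : ∃ b : ℝ, delta p w 0 / (p : ℂ) ^ 2 = b ∧ ‖b‖ ≤ 1 := by
  rcases delta_eq_zero_or_one p w 0 with h | h
  · exact ⟨0, by simp [h], by simp⟩
  · refine ⟨1 / (p : ℝ) ^ 2, by rw [h]; push_cast; rfl, ?_⟩
    rw [Real.norm_of_nonneg (by positivity)]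
    rcases p.eq_zero_or_pos with rfl | hp
    · simp
    · have : (1 : ℝ) ≤ p := by exact_mod_cast hp
      exact div_le_one_of_le₀ (one_le_pow₀ this) (by positivity)

/-- The progressions `pn` and `p²n` are the cases `a = 1` and `a = p`. The `δ` term sits at an
exponent smaller by the factor `p²`. -/
theorem eventuallyTuran_alpha2_mul {p : ℕ} (hp : p.Prime) (w : K3Lattice) {m : ℤ}
    (hm : selfIntersection w = 2 * m) (hpm : (p : ℤ) ∣ m) {a : ℕ} (ha : a = 1 ∨ a = p) :
    EventuallyTuran fun n => alpha2 p w (p * (a * n : ℕ)) := by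
  have hp0 : 0 < p := hp.pos
  have hpR : (0 : ℝ) < p := by exact_mod_cast hp0
  have hp2 : (2 : ℝ) ≤ p := by exact_mod_cast hp.two_le
  have ha0 : 0 < a := by
    rcases ha with rfl | rfl
    · exact one_pos
    · exact hp0
  obtain ⟨b, hb, hb1⟩ := delta_div_im p w
  have hcoeff : ∀ n : ℕ, alpha2 p w (p * (a * n : ℕ)) =
      b * etaInv24.coeff (((a * n : ℕ) : ℤ) / p : ℚ) +
        etaInv24.coeff ((p * (a * n : ℕ) : ℤ) : ℚ) := fun n => by
    rw [alpha2_eq hp0 w hm, hb, if_pos hpm, one_mul]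
  obtain ⟨C, hC, hbound⟩ := exists_etaInv24_bound
  refine eventuallyTuran_of_approx (A := p * a) (Nat.mul_pos hp0 ha0) (B := 0) (K := 1) (C := C)
    one_pos hC.le (Eventually.of_forall fun n => ?_) (Eventually.of_forall fun n => ?_)
  · rw [hcoeff, Complex.add_im, Complex.im_ofReal_mul, etaInv24_coeff_im, etaInv24_coeff_im,
      mul_zero, add_zero]
  · have hi : (p * (a * n : ℕ) : ℤ) + 1 = ((p * a : ℕ) : ℤ) * n + 0 + 1 := by
      push_cast
      ring
    have h0 : -1 ≤ (p * (a * n : ℕ) : ℤ) := by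
      have : (0 : ℤ) ≤ (p * (a * n : ℕ) : ℤ) := by positivity
      omega
    rw [hcoeff, etaInv24_coeff_intCast h0, hi, Complex.ofReal_one, one_mul, add_sub_cancel_right,
      norm_mul, Complex.norm_real]
    refine (mul_le_of_le_one_left (norm_nonneg _) hb1).trans (hbound _ _ ?_)
    push_cast
    rw [add_zero, div_le_div_iff₀ hpR (by norm_num)]
    have h4 : (4 : ℝ) ≤ p ^ 2 := by nlinarith
    have h5 : (0 : ℝ) ≤ a * n := by positivity
    nlinarith [mul_le_mul_of_nonneg_left h4 h5]

theorem eventuallyTuran_zero {α : ℕ → ℂ} (h : ∀ n, α n = 0) : EventuallyTuran α := fun d =>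
  ⟨0, fun n _ => ⟨0, by simp [jensenPoly, h], Splits.zero⟩⟩

end VafaWitten

theorem theorem1p7 (r : ℕ) (hr : 0 < r) (p : ℕ) (hp : p.Prime) (ρ : ℕ) :
    VafaWitten.EventuallyTuran (fun n => VafaWitten.alpha1 r n) ∧
    VafaWitten.EventuallyTuran (fun n => VafaWitten.alpha3 p ρ ((p : ℤ) * n)) ∧
    (∀ w : VafaWitten.K3Lattice, Int.gcd (2 * p) (VafaWitten.selfIntersection w) = 1 →
      VafaWitten.EventuallyTuran (fun n => VafaWitten.alpha2 p w n)) ∧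
    (∀ w : VafaWitten.K3Lattice, (∃ m : ℤ, VafaWitten.selfIntersection w = 2 * p * m) →
      VafaWitten.EventuallyTuran (fun n => VafaWitten.alpha2 p w ((p : ℤ) * n))) ∧
    (∀ w : VafaWitten.K3Lattice,
      VafaWitten.EventuallyTuran (fun n => VafaWitten.alpha2 p w ((p : ℤ) ^ 2 * n))) := by
  refine ⟨VafaWitten.eventuallyTuran_alpha1 hr, VafaWitten.eventuallyTuran_alpha3 hp ρ,
    fun w hw => ?_, fun w hw => ?_, fun w => ?_⟩
  -- Evenness of the form makes 2 a common divisor, contradicting coprimality.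
  · obtain ⟨m, hm⟩ := VafaWitten.exists_selfIntersection_eq w
    have h2 : 2 ∣ Int.gcd (2 * p) (VafaWitten.selfIntersection w) :=
      Int.natCast_dvd_natCast.1 (Int.dvd_coe_gcd (Dvd.intro _ rfl) (Dvd.intro _ hm.symm))
    rw [hw] at h2
    exact absurd h2 (by norm_num)
  · obtain ⟨m, hm⟩ := hw
    have h := VafaWitten.eventuallyTuran_alpha2_mul hp w (m := p * m) (by rw [hm]; ring)
      (Dvd.intro _ rfl) (Or.inl rfl)
    simpa using h
  · obtain ⟨m, hm⟩ := VafaWitten.exists_selfIntersection_eq w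
    by_cases hpm : (p : ℤ) ∣ m
    · have h := VafaWitten.eventuallyTuran_alpha2_mul hp w hm hpm (Or.inr rfl)
      have e : ∀ n : ℕ, (p : ℤ) * ((p * n : ℕ) : ℤ) = (p : ℤ) ^ 2 * n := fun n => by
        push_cast
        ring
      simpa only [e] using h
    -- If `p` does not divide `w²/2`, the character sum vanishes. So does `δ`, because `w = pv`
    -- would give `w²/2 = p² · (v²/2)`. The sequence is identically zero.
    · refine VafaWitten.eventuallyTuran_zero fun n => ?_
      have hδ : VafaWitten.delta p w 0 = 0 := by
        unfold VafaWitten.delta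
        refine if_neg ?_
        rintro ⟨v, hv⟩
        rw [sub_zero] at hv
        obtain ⟨k, hk⟩ := VafaWitten.exists_selfIntersection_eq v
        rw [hv, VafaWitten.selfIntersection_smul, hk] at hm
        refine hpm ⟨p * k, ?_⟩
        linarith
      have e : (p : ℤ) ^ 2 * n = p * (p * n : ℤ) := by ring
      rw [e, VafaWitten.alpha2_eq hp.pos w hm, hδ, if_neg hpm]
      simp
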